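/- **Setting.** We work in the strand space model with symbolic (Dolev–Yao) messages. Messages are built from sorted atoms (names, texts, 32-byte and 48-byte randoms, labels, public and private asymmetric keys), Diffie–Hellman exponents (elements of the free abelian group on random exponents) and group elements $g^e$, by concatenation, encryption/signature $\{m\}_k$ and hashing. A term is *carried* by a message if it can be reached through concatenations and plaintexts (not through keys or hashes); it *originates* at a node that transmits it and is the first on its strand to carry it; a random exponent is *generated* at a node that transmits it and is the first on its strand in which it occurs at all. A *bundle* is a finite acyclic graph of initial segments of strands in which each received message has a unique incoming edge, from a node of another strand transmitting that message; $\prec$ is the causal order of its nodes. Strands are instances of the protocol's roles or penetrator strands (creating atoms, random exponents, the unit exponent and $g$; relaying; concatenating, separating, encrypting, decrypting, hashing; multiplying and inverting exponents; exponentiating). **Models.** There are twelve models: no channel binding over TLS 1.2-RSA, TLS 1.2-DH and TLS 1.3; token binding, channel ID, server endpoint and server certificate binding over TLS 1.2-RSA and over TLS 1.2-DH; exporter binding over TLS 1.3. Each has the four roles client-reg, server-reg, client-auth, server-auth. A client role and a server role are called complementary. Each role first performs the handshake ($C$ client, $S$ server; $cr,sr$ the client and server randoms; $\mathit{Cert}=\{server,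 pk\}_{\mathrm{priv}(ca)}$, with $pk$ the server's public key): * TLS 1.2-RSA: $C\to S: cr$; $S\to C: sr,\mathit{Cert}$; $C\to S:\{pms\}_{pk}$; $C\to S$: Finished under $cwk$; $S\to C$: Finished under $swk$. * TLS 1.2-DH: the same, with $S\to C: sr,\mathit{Cert},g^y,\{cr,sr,g^y\}_{pk^{-1}}$ and $C\to S: g^x$ as second and third messages. * TLS 1.3: $C\to S: cr,g^x$; $S\to C: sr,g^y$; $S\to C$: $\mathit{Cert}$, signature of the transcript, and Finished, under the server handshake key; $C\to S$: Finished under the client handshake key. The master secret and the write keys $cwk, swk$ are labelled hashes of $pms$ (resp. $g^{xy}$) and the nonces or transcript; the Finished messages are labelled hashes of the master secret (TLS 1.3: of the handshake key) and the transcript. Then registration is $$S\to C:\{username, appid, challenge\}_{swk},\qquad C\to S:\{h, aaid, K_{pub}, fc, s\}_{cwk},$$ and authentication is $S\to C:\{appid, challenge\}_{swk}$, $C\to S:\{fc,n,\{fc,n\}_{K_{priv}}\}_{cwk}$, where $h=\mathrm{hash}(K_{priv},username)$, $fc=\mathrm{hash}(appid,challenge,tlsData)$, $s=\{aaid,fc,K_{pub}\}_{A}$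 with $A$ the attestation key, and $tlsData$ is the channel binding of the model: a constant for no binding; a labelled hash of the challenge with the client's binding public key and its self-signature (token binding, channel ID), with $\mathrm{hash}(\mathit{Cert})$ (endpoint) or with $\mathit{Cert}$ (server certificate); or a hash of the master secret, $cr$, $sr$ and labels (exporter). Client and server strands have the same message sequence with opposite signs. A strand's own Diffie–Hellman exponent is a random exponent, its peer's is an arbitrary exponent; in the Diffie–Hellman models, server roles generate their exponent uniquely. **Client assumptions** on a client-reg strand $s$ of a bundle: the private keys of $ca$ and of the server, and $K_{priv}$, are carried by no message; $cr$ originates at exactly one node, on $s$; and $pms$ originates at exactly one node, on $s$ (RSA), resp. $x$ is generated at exactly one node, on $s$ (Diffie–Hellman). **Registration context.** Two strands satisfy it if they agree on $server, ca, cr, sr$, on $pms$ (RSA) resp. on $x,y$ (Diffie–Hellman), and on $challenge$, $username$, $appid$. **Goal 1.** For a role $R$ let $\mathrm{Succ}_j(R)$ be the statement: in every bundle of the model, for every full-height client-reg strand $s$ satisfying the client assumptions, there is a strand $s'$ of role $R$, with $R$ complementary to client-reg, of height at least $j$ in the bundle, such that $s,s'$ satisfy the registration context. Goal 1 states that for some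 $j$ not above the height of server-reg, $\mathrm{Succ}_j(\text{server-reg})$ holds, and that any two roles $R_1,R_2$ for which $\mathrm{Succ}_j$ holds are equal. **Theorem 1.** In each of the twelve models, the following hold, $n$ being the full height of the registration roles. 1. Goal 1 holds for client-reg and server-reg, and it holds in particular for $j=n-1$ (a server that has sent its challenge). 2. There is a single shape, the ideal execution: (a) For all well-sorted values of the variables with $cr\neq sr$ (and $x\neq y$ in the Diffie–Hellman models), the execution consisting of exactly one full client-reg strand and one server-reg strand of height $n-1$ with these values, each receiving exactly what the other sent, is a bundle of the model; the client assumptions hold in it, and $sr$ originates at exactly one node, on the server strand. (b) In every bundle of the model and for every full-height client-reg strand $s$ satisfying the client assumptions whose server random $sr$ originates at exactly one node of the bundle, lying on a server strand, there is a server-reg strand $s'$ of height at least $n-1$ such that for each $k<n-1$ the $k$-th messages of $s$ and $s'$ are equal with opposite signs and the transmission $\prec$ the reception; and $s'$ is the only complementary strand of height at least $n-1$ that satisfies the registration context with $s$. -/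

import Mathlib

namespace UAF

/-! ## Messages -/

/-- Asymmetric key pairs: the long-term pair belonging to a name, or any other pair. -/
inductive AKey where
  | longTerm (name : ℕ)
  | other (i : ℕ)

/-- Public constants (labels) used by the protocols. -/
inductive Tag where
  | masterSecret | handshakeSecret
  | clientWrite | serverWrite
  | clientHandshake | serverHandshake
  | clientFinished | serverFinished | certificateVerify
  | unbound | channelId | tokenBinding | serverEndpoint | serverCert
  | exporterLabel | exporterContext

/-- Atomic messages, separated by sort. -/
inductive Atom where
  | name (n : ℕ)
  | text (n : ℕ)
  | random32 (n : ℕ)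
  | random48 (n : ℕ)
  | tag (t : Tag)
  | pub (k : AKey)
  | priv (k : AKey)

/-- Diffie-Hellman exponents: the free abelian group on the random exponents.  The group is
written additively, so `e + f` is the *product* of the exponents `e` and `f`. -/
abbrev Expt := ℕ →₀ ℤ

/-- The exponent consisting of the `a`-th random exponent. -/
noncomputable def Expt.var (a : ℕ) : Expt := Finsupp.single a 1

/-- The message algebra. `dh e` is the generator of the Diffie-Hellman group raised to `e`;
`enc p k` is `p` encrypted (or signed, when `k` is a private key) under `k`. -/
inductive Msg where
  | atom (a : Atom)
  | expt (e : Expt)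
  | dh (e : Expt)
  | pair (m n : Msg)
  | enc (plain key : Msg)
  | hash (m : Msg)

namespace Msg

abbrev name (n : ℕ) : Msg := .atom (.name n)
abbrev text (n : ℕ) : Msg := .atom (.text n)
abbrev random32 (n : ℕ) : Msg := .atom (.random32 n)
abbrev random48 (n : ℕ) : Msg := .atom (.random48 n)
abbrev tag (t : Tag) : Msg := .atom (.tag t)
abbrev pub (k : AKey) : Msg := .atom (.pub k)
abbrev priv (k : AKey) : Msg := .atom (.priv k)

/-- The decryption key for a given encryption key; all keys but the asymmetric ones are
symmetric. -/
def inverse : Msg → Msg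
  | .atom (.pub k) => .atom (.priv k)
  | .atom (.priv k) => .atom (.pub k)
  | m => m

/-- `m.Carries t`: `t` is carried by `m`, i.e. it can be extracted from `m` by separating pairs
and decrypting. Keys and hashed messages are not carried. -/
def Carries : Msg → Msg → Prop
  | .atom a, t => t = .atom a
  | .expt e, t => t = .expt e
  | .dh e, t => t = .dh e
  | .pair m n, t => t = .pair m n ∨ m.Carries t ∨ n.Carries t
  | .enc p k, t => t = .enc p k ∨ p.Carries t
  | .hash m, t => t = .hash m

/-- The random exponent `a` occurs anywhere in the message, also in a key or under a hash. -/
def ExptOccurs (a : ℕ) : Msg → Prop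
  | .atom _ => False
  | .expt e => e a ≠ 0
  | .dh e => e a ≠ 0
  | .pair m n => ExptOccurs a m ∨ ExptOccurs a n
  | .enc p k => ExptOccurs a p ∨ ExptOccurs a k
  | .hash m => ExptOccurs a m

end Msg

/-- Concatenation of messages associates to the right. -/
infixr:65 " ⋆ " => Msg.pair

/-- Transmission or reception of a message. -/
inductive Event where
  | send (m : Msg)
  | recv (m : Msg)

def Event.msg : Event → Msg
  | .send m => m
  | .recv m => m

/-! ## The models -/

/-- TLS 1.2 with RSA key exchange, TLS 1.2 with ephemeral Diffie-Hellman, TLS 1.3. -/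
inductive TLS where
  | rsa12 | dh12 | tls13

/-- The key exchange is Diffie-Hellman. -/
def TLS.IsDH : TLS → Prop
  | .rsa12 => False
  | .dh12 => True
  | .tls13 => True

inductive Binding where
  | noBinding | token | channelId | endpoint | serverCert | exporter

/-- The twelve modelled combinations: no binding over every TLS variant, the four bindings of the
standard over both variants of TLS 1.2, and the exporter binding over TLS 1.3. -/
def Modelled : TLS → Binding → Prop
  | _, .noBinding => True
  | .tls13, .exporter => True
  | .rsa12, .exporter => False
  | .dh12, .exporter => False
  | .tls13, _ => False
  | _, _ => True

/-- The values of the variables of a protocol role. -/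
structure Env where
  /-- names of the user, authenticator, server, certificate authority, application, and the owner
  of the client's binding key -/
  username : ℕ
  auth : ℕ
  server : ℕ
  ca : ℕ
  appid : ℕ
  client : ℕ
  /-- the server's challenge -/
  challenge : ℕ
  /-- TLS client random and server random -/
  cr : ℕ
  sr : ℕ
  /-- premaster secret (RSA only) -/
  pms : ℕ
  /-- client and server Diffie-Hellman exponents (Diffie-Hellman only) -/
  x : Expt
  y : Expt
  /-- the server's key pair (TLS 1.3 only) -/
  spk : AKey
  /-- the authenticator's key pair for this relying party -/
  authk : AKey
  /-- the authenticator's nonce (authentication only) -/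
  nonce : ℕ

section Macros

variable (v : TLS) (b : Binding) (e : Env)

/-- The server's key pair. In TLS 1.2 it is the long-term pair of its name. -/
def serverKey : AKey :=
  match v with
  | .tls13 => e.spk
  | _ => .longTerm e.server

/-- Server certificate, signed by the certificate authority. -/
def certificate : Msg :=
  .enc (.name e.server ⋆ .pub (serverKey v e)) (.priv (.longTerm e.ca))

/-- The shared Diffie-Hellman value. -/
noncomputable def dhShared : Msg := .dh (e.x + e.y)

/-- TLS 1.3 handshake secret. -/
noncomputable def handshakeSecret : Msg := .hash (.tag .handshakeSecret ⋆ dhShared e)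

/-- Master secret. -/
noncomputable def masterSecret : Msg :=
  match v with
  | .rsa12 => .hash (.tag .masterSecret ⋆ .random48 e.pms ⋆ .random32 e.cr ⋆ .random32 e.sr)
  | .dh12 => .hash (.tag .masterSecret ⋆ dhShared e ⋆ .random32 e.cr ⋆ .random32 e.sr)
  | .tls13 => .hash (.tag .masterSecret ⋆ handshakeSecret e)

/-- TLS 1.2: the server's first flight (ServerHello, Certificate and, for Diffie-Hellman, the
signed ServerKeyExchange). -/
noncomputable def serverFlight12 : Msg :=
  match v with
  | .rsa12 => .random32 e.sr ⋆ certificate v e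
  | _ => .random32 e.sr ⋆ certificate v e ⋆ .dh e.y ⋆
      .enc (.random32 e.cr ⋆ .random32 e.sr ⋆ .dh e.y) (.priv (serverKey v e))

/-- TLS 1.2 ClientKeyExchange. -/
noncomputable def clientKeyExchange12 : Msg :=
  match v with
  | .rsa12 => .enc (.random48 e.pms) (.pub (serverKey v e))
  | _ => .dh e.x

/-- TLS 1.2: transcript of the handshake before the Finished messages. -/
noncomputable def transcript12 : Msg :=
  .random32 e.cr ⋆ serverFlight12 v e ⋆ clientKeyExchange12 v e

/-- TLS 1.2 verification data of the client's Finished message. -/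
noncomputable def clientFinished12 : Msg :=
  .hash (.tag .clientFinished ⋆ masterSecret v e ⋆ .hash (transcript12 v e))

/-- TLS 1.2 verification data of the server's Finished message. -/
noncomputable def serverFinished12 : Msg :=
  .hash (.tag .serverFinished ⋆ masterSecret v e ⋆
    .hash (transcript12 v e ⋆ clientFinished12 v e))

/-- TLS 1.3 ClientHello and ServerHello, with key shares. -/
noncomputable def hellos13 : Msg :=
  (.random32 e.cr ⋆ .dh e.x) ⋆ (.random32 e.sr ⋆ .dh e.y)

/-- TLS 1.3 handshake traffic key of the client resp. server. -/
noncomputable def handshakeKey13 (t : Tag) : Msg :=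
  .hash (.tag t ⋆ handshakeSecret e ⋆ .hash (hellos13 e))

/-- TLS 1.3 CertificateVerify: signature of the transcript. -/
noncomputable def certificateVerify13 : Msg :=
  .enc (.tag .certificateVerify ⋆ .hash (hellos13 e ⋆ certificate .tls13 e)) (.priv e.spk)

/-- TLS 1.3 verification data of the server's Finished message. -/
noncomputable def serverFinished13 : Msg :=
  .hash (.tag .serverFinished ⋆ handshakeKey13 e .serverHandshake ⋆
    .hash (hellos13 e ⋆ certificate .tls13 e ⋆ certificateVerify13 e))

/-- TLS 1.3 transcript up to the server's Finished message. -/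
noncomputable def transcript13 : Msg :=
  hellos13 e ⋆ certificate .tls13 e ⋆ certificateVerify13 e ⋆ serverFinished13 e

/-- TLS 1.3 verification data of the client's Finished message. -/
noncomputable def clientFinished13 : Msg :=
  .hash (.tag .clientFinished ⋆ handshakeKey13 e .clientHandshake ⋆ .hash (transcript13 e))

/-- Write key (application traffic key in TLS 1.3) of the client resp. server. -/
noncomputable def writeKey (t : Tag) : Msg :=
  match v with
  | .tls13 => .hash (.tag t ⋆ masterSecret v e ⋆ .hash (transcript13 e))
  | _ => .hash (.tag t ⋆ masterSecret v e ⋆ .random32 e.cr ⋆ .random32 e.sr)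

noncomputable def cwk : Msg := writeKey v e .clientWrite

noncomputable def swk : Msg := writeKey v e .serverWrite

/-- Channel binding data. -/
noncomputable def tlsData : Msg :=
  match b with
  | .noBinding => .tag .unbound
  | .channelId => .hash (.tag .channelId ⋆ .text e.challenge ⋆ .pub (.longTerm e.client) ⋆
      .enc (.pub (.longTerm e.client)) (.priv (.longTerm e.client)))
  | .token => .hash (.tag .tokenBinding ⋆ .text e.challenge ⋆ .pub (.longTerm e.client) ⋆
      .enc (.pub (.longTerm e.client)) (.priv (.longTerm e.client)))
  | .endpoint => .hash (.tag .serverEndpoint ⋆ .text e.challenge ⋆ .hash (certificate v e))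
  | .serverCert => .hash (.tag .serverCert ⋆ .text e.challenge ⋆ certificate v e)
  | .exporter => .hash (masterSecret v e ⋆ .tag .exporterLabel ⋆ .random32 e.cr ⋆
      .random32 e.sr ⋆ .tag .exporterContext)

/-- Final challenge. -/
noncomputable def finalChallenge : Msg :=
  .hash (.name e.appid ⋆ .text e.challenge ⋆ tlsData v b e)

/-- Key handle. -/
def keyHandle : Msg := .hash (.priv e.authk ⋆ .name e.username)

/-- Registration assertion, signed by the authenticator's attestation key. -/
noncomputable def regAssertion : Msg :=
  .enc (.name e.auth ⋆ finalChallenge v b e ⋆ .pub e.authk) (.priv (.longTerm e.auth))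

/-- Authentication assertion, signed by the authentication key. -/
noncomputable def authAssertion : Msg :=
  .enc (finalChallenge v b e ⋆ .text e.nonce) (.priv e.authk)

end Macros

/-- Events of a client and a server, given in the order of the protocol: `up m` is a message from
the client to the server, `down m` one from the server to the client. -/
inductive Flow where
  | up (m : Msg)
  | down (m : Msg)

def Flow.clientEvent : Flow → Event
  | .up m => .send m
  | .down m => .recv m

def Flow.serverEvent : Flow → Event
  | .up m => .recv m
  | .down m => .send m

/-- The TLS handshake. -/
noncomputable def handshake (v : TLS) (e : Env) : List Flow :=
  match v with
  | .tls13 =>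
    [ .up (.random32 e.cr ⋆ .dh e.x),
      .down (.random32 e.sr ⋆ .dh e.y),
      .down (.enc (certificate .tls13 e ⋆ certificateVerify13 e ⋆ serverFinished13 e)
        (handshakeKey13 e .serverHandshake)),
      .up (.enc (clientFinished13 e) (handshakeKey13 e .clientHandshake)) ]
  | v =>
    [ .up (.random32 e.cr),
      .down (serverFlight12 v e),
      .up (clientKeyExchange12 v e),
      .up (.enc (clientFinished12 v e) (cwk v e)),
      .down (.enc (serverFinished12 v e) (swk v e)) ]

/-- Number of messages of the handshake. -/
def handshakeLength : TLS → ℕ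
  | .rsa12 => 5
  | .dh12 => 5
  | .tls13 => 4

theorem length_handshake (v : TLS) (e : Env) : (handshake v e).length = handshakeLength v := by
  cases v <;> rfl

/-- The regular roles of each model. -/
inductive Role where
  | clientReg | serverReg | clientAuth | serverAuth

def Role.IsClient : Role → Prop
  | .clientReg => True
  | .clientAuth => True
  | .serverReg => False
  | .serverAuth => False

def Role.IsServer (r : Role) : Prop := ¬ r.IsClient

/-- Complementary roles: one is a client role and the other a server role. -/
def Role.Complementary (r r' : Role) : Prop := r.IsClient ↔ r'.IsServer

/-- Registration, after the handshake. -/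
noncomputable def registration (v : TLS) (b : Binding) (e : Env) : List Flow :=
  [ .down (.enc (.name e.username ⋆ .name e.appid ⋆ .text e.challenge) (swk v e)),
    .up (.enc (keyHandle e ⋆ .name e.auth ⋆ .pub e.authk ⋆ finalChallenge v b e ⋆
      regAssertion v b e) (cwk v e)) ]

/-- Authentication, after the handshake. -/
noncomputable def authentication (v : TLS) (b : Binding) (e : Env) : List Flow :=
  [ .down (.enc (.name e.appid ⋆ .text e.challenge) (swk v e)),
    .up (.enc (finalChallenge v b e ⋆ .text e.nonce ⋆ authAssertion v b e) (cwk v e)) ]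

/-- Trace of an instance of a role. -/
noncomputable def roleTrace (v : TLS) (b : Binding) (r : Role) (e : Env) : List Event :=
  match r with
  | .clientReg => (handshake v e ++ registration v b e).map Flow.clientEvent
  | .serverReg => (handshake v e ++ registration v b e).map Flow.serverEvent
  | .clientAuth => (handshake v e ++ authentication v b e).map Flow.clientEvent
  | .serverAuth => (handshake v e ++ authentication v b e).map Flow.serverEvent

/-- Height of a fully executing strand of a role. -/
def roleHeight (v : TLS) (_r : Role) : ℕ := handshakeLength v + 2

theorem length_roleTrace (v : TLS) (b : Binding) (r : Role) (e : Env) :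
    (roleTrace v b r e).length = roleHeight v r := by
  cases v <;> cases r <;> rfl

/-- Sorts of the Diffie-Hellman exponents: a strand's own exponent is a random exponent, whereas
its peer's exponent is arbitrary. -/
def WellSorted (v : TLS) (r : Role) (e : Env) : Prop :=
  v.IsDH → (r.IsClient → ∃ a, e.x = Expt.var a) ∧ (r.IsServer → ∃ a, e.y = Expt.var a)

/-! ## Strands and bundles -/

/-- Penetrator strands. -/
inductive Penetrator where
  | create (a : Atom)
  | createExpt (a : ℕ)
  | one
  | generator
  | relay (m : Msg)
  | concat (m n : Msg)
  | separate (m n : Msg)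
  | encrypt (p k : Msg)
  | decrypt (p k : Msg)
  | hash (m : Msg)
  | multiply (e f : Expt)
  | invert (e : Expt)
  | exponentiate (e f : Expt)

noncomputable def Penetrator.trace : Penetrator → List Event
  | .create a => [.send (.atom a)]
  | .createExpt a => [.send (.expt (Expt.var a))]
  | .one => [.send (.expt 0)]
  | .generator => [.send (.dh 0)]
  | .relay m => [.recv m, .send m]
  | .concat m n => [.recv m, .recv n, .send (m ⋆ n)]
  | .separate m n => [.recv (m ⋆ n), .send m, .send n]
  | .encrypt p k => [.recv k, .recv p, .send (.enc p k)]
  | .decrypt p k => [.recv k.inverse, .recv (.enc p k), .send p]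
  | .hash m => [.recv m, .send (.hash m)]
  | .multiply e f => [.recv (.expt e), .recv (.expt f), .send (.expt (e + f))]
  | .invert e => [.recv (.expt e), .send (.expt (-e))]
  | .exponentiate e f => [.recv (.dh e), .recv (.expt f), .send (.dh (e + f))]

inductive Strand where
  | regular (r : Role) (e : Env)
  | penetrator (p : Penetrator)

noncomputable def Strand.trace (v : TLS) (b : Binding) : Strand → List Event
  | .regular r e => roleTrace v b r e
  | .penetrator p => p.trace

/-- A finite graph of strands: finitely many strands, the number of nodes of each one that are
present (so that the predecessors of a node on its strand are present), and communication edges.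
The node `(i, k)` is the `k`-th node (counting from `0`) of the strand `i`. -/
structure Graph where
  size : ℕ
  strand : Fin size → Strand
  height : Fin size → ℕ
  comm : Fin size × ℕ → Fin size × ℕ → Prop

namespace Graph

variable (v : TLS) (b : Binding) (B : Graph)

/-- The node `n` is present and its event is `ev`. -/
def HasEvent (n : Fin B.size × ℕ) (ev : Event) : Prop :=
  n.2 < B.height n.1 ∧ ((B.strand n.1).trace v b)[n.2]? = some ev

/-- Edges of the graph: communication, or succession on a strand. -/
def Edge (n n' : Fin B.size × ℕ) : Prop :=
  B.comm n n' ∨ (n'.1 = n.1 ∧ n'.2 = n.2 + 1 ∧ n'.2 < B.height n.1)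

/-- Causal precedence. -/
def Precedes : Fin B.size × ℕ → Fin B.size × ℕ → Prop := Relation.TransGen B.Edge

/-- Bundles. -/
structure IsBundle : Prop where
  height_pos : ∀ i, 0 < B.height i
  height_le : ∀ i, B.height i ≤ ((B.strand i).trace v b).length
  comm_event : ∀ n n', B.comm n n' →
    n.1 ≠ n'.1 ∧ ∃ m, B.HasEvent v b n (.send m) ∧ B.HasEvent v b n' (.recv m)
  recv_unique : ∀ n' m, B.HasEvent v b n' (.recv m) → ∃! n, B.comm n n'
  acyclic : ∀ n, ¬ B.Precedes n n

/-- `t` originates at the node `n`: it is transmitted there, and first carried on its strand. -/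
def OriginatesAt (t : Msg) (n : Fin B.size × ℕ) : Prop :=
  (∃ m, B.HasEvent v b n (.send m) ∧ m.Carries t) ∧
  ∀ k < n.2, ∀ ev, B.HasEvent v b (n.1, k) ev → ¬ ev.msg.Carries t

/-- The random exponent `a` is generated at the node `n`: it is transmitted there, and first
occurs on its strand. -/
def GeneratesAt (a : ℕ) (n : Fin B.size × ℕ) : Prop :=
  (∃ m, B.HasEvent v b n (.send m) ∧ m.ExptOccurs a) ∧
  ∀ k < n.2, ∀ ev, B.HasEvent v b (n.1, k) ev → ¬ ev.msg.ExptOccurs a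

/-- `t` is non-originating: it is never carried. -/
def NonOrig (t : Msg) : Prop := ∀ n ev, B.HasEvent v b n ev → ¬ ev.msg.Carries t

/-- `t` originates uniquely, and does so on the strand `i`. -/
def UniqOrig (t : Msg) (i : Fin B.size) : Prop :=
  ∃ k, ∀ n, B.OriginatesAt v b t n ↔ n = (i, k)

/-- `a` is uniquely generated, and is so on the strand `i`. -/
def UniqGen (a : ℕ) (i : Fin B.size) : Prop :=
  ∃ k, ∀ n, B.GeneratesAt v b a n ↔ n = (i, k)

/-- The bundles of the strand space of the model `(v, b)`. Regular strands are well-sorted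
instances of the roles; in the Diffie-Hellman models the server roles declare the server's own
exponent to be uniquely generated (it first occurs in the second message). -/
structure InSpace : Prop where
  isBundle : B.IsBundle v b
  wellSorted : ∀ i r e, B.strand i = .regular r e → WellSorted v r e
  server_fresh : v.IsDH → ∀ i r e a, B.strand i = .regular r e → r.IsServer →
    2 ≤ B.height i → e.y = Expt.var a → B.UniqGen v b a i

end Graph

/-! ## Session context agreement -/

/-- Relation between two regular strands (role and values of the variables). -/
abbrev Context := Role × Env → Role × Env → Prop

/-- Assumptions on a strand with given variable values in a graph. -/
abbrev Assumptions := (B : Graph) → Fin B.size → Env → Prop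

/-- `Succ(R, R', Ctx, Orig, i, j)`. -/
def Successful (v : TLS) (b : Binding) (R R' : Role) (Ctx : Context) (Orig : Assumptions)
    (i j : ℕ) : Prop :=
  ∀ B : Graph, B.InSpace v b → ∀ s e, B.strand s = .regular R e → i ≤ B.height s →
    Orig B s e →
    ∃ s' e', B.strand s' = .regular R' e' ∧ j ≤ B.height s' ∧ R.Complementary R' ∧
      Ctx (R, e) (R', e')

/-- `Uniq(R, Ctx, Orig, i, j)`. -/
def UniqueCompletion (v : TLS) (b : Binding) (R : Role) (Ctx : Context) (Orig : Assumptions)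
    (i j : ℕ) : Prop :=
  ∀ R₁ R₂ : Role, Successful v b R R₁ Ctx Orig i j → Successful v b R R₂ Ctx Orig i j → R₁ = R₂

/-- Session context agreement with a given height of the complementary strand. -/
def ContextAgreementAt (v : TLS) (b : Binding) (R R' : Role) (Ctx : Context)
    (Orig : Assumptions) (j : ℕ) : Prop :=
  Successful v b R R' Ctx Orig (roleHeight v R) j ∧
    UniqueCompletion v b R Ctx Orig (roleHeight v R) j

/-- Session context agreement. -/
def ContextAgreement (v : TLS) (b : Binding) (R R' : Role) (Ctx : Context)
    (Orig : Assumptions) : Prop :=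
  ∃ j ≤ roleHeight v R', ContextAgreementAt v b R R' Ctx Orig j

/-! ## Registration context and client assumptions -/

/-- The variables that occur in session contexts. -/
inductive Var where
  | server | ca | cr | sr | pms | x | y | challenge | username | appid

/-- Value of a variable in an instance of a role, if the role has that variable. -/
noncomputable def value (v : TLS) (s : Role × Env) : Var → Option Msg
  | .server => some (.name s.2.server)
  | .ca => some (.name s.2.ca)
  | .cr => some (.random32 s.2.cr)
  | .sr => some (.random32 s.2.sr)
  | .pms => match v with
    | .rsa12 => some (.random48 s.2.pms)
    | _ => none
  | .x => match v with
    | .rsa12 => none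
    | _ => some (.expt s.2.x)
  | .y => match v with
    | .rsa12 => none
    | _ => some (.expt s.2.y)
  | .challenge => some (.text s.2.challenge)
  | .username => match s.1 with
    | .clientReg => some (.name s.2.username)
    | .serverReg => some (.name s.2.username)
    | _ => none
  | .appid => some (.name s.2.appid)

/-- Two strands have the variable and agree on its value. -/
def Agree (v : TLS) (z : Var) (s s' : Role × Env) : Prop :=
  ∃ m, value v s z = some m ∧ value v s' z = some m

/-- Variables of the TLS session context. -/
def tlsContextVars : TLS → List Var
  | .rsa12 => [.server, .ca, .cr, .sr, .pms]
  | _ => [.server, .ca, .cr, .sr, .x, .y]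

/-- The registration session context. -/
def regContext (v : TLS) : Context := fun s s' =>
  ∀ z ∈ tlsContextVars v ++ [.challenge, .username, .server, .appid], Agree v z s s'

/-- The client assumptions: the private keys of the certificate authority and the server, and the
private authentication key, are non-originating; the client random and the premaster secret
(RSA) or Diffie-Hellman exponent are fresh. -/
def clientAssumptions (v : TLS) (b : Binding) : Assumptions := fun B s e =>
  B.NonOrig v b (.priv (.longTerm e.ca)) ∧
  B.NonOrig v b (.priv (serverKey v e)) ∧
  B.NonOrig v b (.priv e.authk) ∧
  B.UniqOrig v b (.random32 e.cr) s ∧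
  match v with
  | .rsa12 => B.UniqOrig v b (.random48 e.pms) s
  | _ => ∃ a, e.x = Expt.var a ∧ B.UniqGen v b a s

/-- The server random of the session originates uniquely, on a server strand. -/
def serverRandomFresh (v : TLS) (b : Binding) : Assumptions := fun B _ e =>
  ∃ t r e', B.strand t = .regular r e' ∧ r.IsServer ∧ B.UniqOrig v b (.random32 e.sr) t

/-! ## The single shape -/

/-- The ideal execution: it has exactly two strands, a full client-reg strand `s` and a server-reg
strand `s'` that misses at most the client's final message, with the same values of the
variables; each receives precisely what the other sent. -/
structure IsIdealExecution (v : TLS) (b : Binding) (e : Env) (B : Graph)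
    (s s' : Fin B.size) : Prop where
  client : B.strand s = .regular .clientReg e
  server : B.strand s' = .regular .serverReg e
  only : ∀ t, t = s ∨ t = s'
  client_height : B.height s = roleHeight v .clientReg
  server_height : B.height s' = handshakeLength v + 1
  comm_iff : ∀ n n', B.comm n n' ↔ n.1 ≠ n'.1 ∧ n.2 = n'.2 ∧
    ∃ m, B.HasEvent v b n (.send m) ∧ B.HasEvent v b n' (.recv m)

/-- The ideal execution occurs in `B` with client `s` and server `s'`: up to the challenge the two
strands exchange the same messages, each one being sent before it is received. -/
structure ContainsIdeal (v : TLS) (b : Binding) (B : Graph) (s s' : Fin B.size) : Prop where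
  server : ∃ e', B.strand s' = .regular .serverReg e'
  height : handshakeLength v + 1 ≤ B.height s'
  matching : ∀ k < handshakeLength v + 1, ∃ m,
    (B.HasEvent v b (s, k) (.send m) ∧ B.HasEvent v b (s', k) (.recv m) ∧
      B.Precedes (s, k) (s', k)) ∨
    (B.HasEvent v b (s, k) (.recv m) ∧ B.HasEvent v b (s', k) (.send m) ∧
      B.Precedes (s', k) (s, k))

/-- The ideal execution is the only shape of the client-reg perspective: it is itself a bundle that
satisfies the assumptions, and it occurs in every bundle that satisfies them, with a unique
complementary strand. -/
def SingleShape (v : TLS) (b : Binding) : Prop :=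
  (∀ e : Env, WellSorted v .clientReg e → WellSorted v .serverReg e → e.cr ≠ e.sr →
    (v.IsDH → e.x ≠ e.y) →
    ∃ (B : Graph) (s s' : Fin B.size), B.InSpace v b ∧ IsIdealExecution v b e B s s' ∧
      clientAssumptions v b B s e ∧ serverRandomFresh v b B s e) ∧
  (∀ B : Graph, B.InSpace v b → ∀ s e, B.strand s = .regular .clientReg e →
    roleHeight v .clientReg ≤ B.height s → clientAssumptions v b B s e →
    serverRandomFresh v b B s e →
    ∃ s', ContainsIdeal v b B s s' ∧
      ∀ t r e', B.strand t = .regular r e' → Role.clientReg.Complementary r →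
        handshakeLength v + 1 ≤ B.height t → regContext v (.clientReg, e) (r, e') → t = s')

end UAF

/-! The client is convinced by keys that the penetrator cannot obtain. Every argument about
arbitrary bundles is an induction along the causal order: a property of messages first holds at some
transmission (`exists_first`), so only regular transmissions and penetrator steps (`Derives`) have
to be examined.

Secrecy. With RSA, the fresh premaster secret travels only inside encryptions under the server's
public key (`guarded_premaster`). With Diffie–Hellman, the server's signature shows that g^y comes
from a server strand, whose exponent is uniquely generated. No carried exponent involves a fresh
random exponent and no carried group element involves two of them (`dhSafe`), so g^(xy), which
involves two, is never carried. Secrecy then descends the key schedule (`not_carries_derived`),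
because the only hashes headed by a label that regular strands let be carried are Finished values.

Authentication. An encryption under a secret key was made by a regular strand
(`exists_regular_of_carries_enc`). The form of the challenge message singles out server-reg. In TLS
1.3 its key hashes the whole transcript, which gives agreement at once. In TLS 1.2 the key binds
only the master secret and the two randoms. Agreement on the rest comes from the client Finished
message that the server received before sending its challenge: it can only stem from the given
client strand, and it hashes the transcript (`clientFinished12_sent`, `exists_server`). The channel
binding enters only the client's last message, so one argument serves all bindings.

Shape. Fresh values and secret keys also place each transmission before the matching reception, and
a fresh server random leaves room for only one server strand. Conversely, the ideal execution is
written down explicitly and checked to be a bundle. It also makes the assumptions satisfiable, so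
that uniqueness of the role reduces to the fact that server-reg is the only server role with a
username. -/

namespace UAF

/-! ### Induction along the causal order -/

namespace Graph

variable {v : TLS} {b : Binding} {B : Graph}

theorem HasEvent.eq {n : Fin B.size × ℕ} {ev ev' : Event} (h : B.HasEvent v b n ev)
    (h' : B.HasEvent v b n ev') : ev = ev' :=
  Option.some.inj (h.2.symm.trans h'.2)

theorem precedes_of_lt {i : Fin B.size} {k l : ℕ} (hkl : k < l) (hl : l < B.height i) :
    B.Precedes (i, k) (i, l) := by
  induction l with
  | zero => omega
  | succ l ih =>
    have step : B.Edge (i, l) (i, l + 1) := .inr ⟨rfl, rfl, hl⟩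
    rcases Nat.lt_succ_iff_lt_or_eq.mp hkl with h | rfl
    · exact (ih h (by omega)).tail step
    · exact .single step

namespace IsBundle

variable (h : B.IsBundle v b)
include h

theorem mem_of_edge {n n' : Fin B.size × ℕ} (he : B.Edge n n') :
    n.2 < B.height n.1 ∧ n'.2 < B.height n'.1 := by
  rcases he with hc | ⟨h1, h2, h3⟩
  · obtain ⟨-, m, hn, hn'⟩ := h.comm_event _ _ hc
    exact ⟨hn.1, hn'.1⟩
  · exact ⟨by omega, h1 ▸ h3⟩

theorem mem_of_precedes {n n' : Fin B.size × ℕ} (hp : B.Precedes n n') :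
    n.2 < B.height n.1 ∧ n'.2 < B.height n'.1 := by
  induction hp with
  | single he => exact h.mem_of_edge he
  | tail _ he ih => exact ⟨ih.1, (h.mem_of_edge he).2⟩

/-- Precedence relates only nodes that are present. These are finitely many, and acyclicity makes
the relation a strict order on them. -/
theorem wellFounded_precedes : WellFounded B.Precedes := by
  have hfin : {n : Fin B.size × ℕ | n.2 < B.height n.1}.Finite := by
    refine ((Set.finite_univ (α := Fin B.size)).biUnion
      fun i _ => (Set.finite_Iio (B.height i)).image (Prod.mk i)).subset ?_
    rintro ⟨i, k⟩ hk
    simpa using hk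
  have : IsStrictOrder _ B.Precedes :=
    { irrefl := h.acyclic, trans := fun _ _ _ => Relation.TransGen.trans }
  refine (Set.wellFoundedOn_iff.mp (hfin.wellFoundedOn (r := B.Precedes))).mono ?_
  intro n n' hp
  exact ⟨hp, h.mem_of_precedes hp⟩

/-- A property that holds of a message in the bundle holds first at some transmission. -/
theorem exists_first (Q : Msg → Prop) (n : Fin B.size × ℕ) :
    ∀ ev, B.HasEvent v b n ev → Q ev.msg →
    ∃ n', ((∃ m, B.HasEvent v b n' (.send m) ∧ Q m) ∧
      ∀ k < n'.2, ∀ ev, B.HasEvent v b (n'.1, k) ev → ¬ Q ev.msg) ∧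
      (n' = n ∨ B.Precedes n' n) := by
  induction n using h.wellFounded_precedes.induction with
  | _ n ih =>
  intro ev hev hQ
  have lift : ∀ n₁ ev₁, B.Precedes n₁ n → B.HasEvent v b n₁ ev₁ → Q ev₁.msg →
      ∃ n', ((∃ m, B.HasEvent v b n' (.send m) ∧ Q m) ∧
      ∀ k < n'.2, ∀ ev, B.HasEvent v b (n'.1, k) ev → ¬ Q ev.msg) ∧
      (n' = n ∨ B.Precedes n' n) := by
    intro n₁ ev₁ hp hev₁ hQ₁
    obtain ⟨n', h1, h2⟩ := ih n₁ hp ev₁ hev₁ hQ₁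
    refine ⟨n', h1, .inr ?_⟩
    rcases h2 with rfl | h2
    · exact hp
    · exact h2.trans hp
  by_cases hk : ∃ k < n.2, ∃ ev, B.HasEvent v b (n.1, k) ev ∧ Q ev.msg
  · obtain ⟨k, hk, ev₁, h1, h2⟩ := hk
    exact lift (n.1, k) ev₁ (precedes_of_lt hk hev.1) h1 h2
  · push Not at hk
    cases ev with
    | send m => exact ⟨n, ⟨⟨m, hev, hQ⟩, hk⟩, .inl rfl⟩
    | recv m =>
      obtain ⟨n₁, hc, -⟩ := h.recv_unique n m hev
      obtain ⟨-, m', h1, h2⟩ := h.comm_event _ _ hc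
      obtain rfl : m = m' := by simpa using hev.eq h2
      exact lift n₁ _ (.single (.inl hc)) h1 hQ

/-- A property that every transmitted message inherits from the earlier messages of its strand
holds of every message. -/
theorem invariant (P : Msg → Prop)
    (H : ∀ n m, B.HasEvent v b n (.send m) →
      (∀ k < n.2, ∀ ev, B.HasEvent v b (n.1, k) ev → P ev.msg) → P m)
    {n : Fin B.size × ℕ} {ev : Event} (hev : B.HasEvent v b n ev) : P ev.msg := by
  by_contra hP
  obtain ⟨n', ⟨⟨m, h1, h2⟩, h3⟩, -⟩ := h.exists_first (fun m => ¬ P m) n ev hev hP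
  exact h2 (H n' m h1 fun k hk ev hev => not_not.mp (h3 k hk ev hev))

/-- Tracing `t` back from its reception ends at a node where it originates, and there is only one
such node. That node is a transmission, hence not the reception itself. -/
theorem precedes_of_uniqOrig {t : Msg} {i j : Fin B.size} {k : ℕ} {n : Fin B.size × ℕ} {m : Msg}
    (hi : B.UniqOrig v b t j) (hk : B.OriginatesAt v b t (i, k))
    (hm : B.HasEvent v b n (.recv m)) (hc : m.Carries t) : B.Precedes (i, k) n := by
  obtain ⟨l, hl⟩ := hi
  obtain ⟨n', h1, h2⟩ := h.exists_first (fun m => m.Carries t) n _ hm hc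
  obtain rfl := (hl n').mp h1
  rw [(hl _).mp hk]
  refine h2.resolve_left ?_
  rintro rfl
  obtain ⟨m', h3, -⟩ := h1.1
  simpa using h3.eq hm

theorem precedes_of_uniqGen {a : ℕ} {i j : Fin B.size} {k : ℕ} {n : Fin B.size × ℕ} {m : Msg}
    (hi : B.UniqGen v b a j) (hk : B.GeneratesAt v b a (i, k))
    (hm : B.HasEvent v b n (.recv m)) (hc : m.ExptOccurs a) : B.Precedes (i, k) n := by
  obtain ⟨l, hl⟩ := hi
  obtain ⟨n', h1, h2⟩ := h.exists_first (fun m => m.ExptOccurs a) n _ hm hc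
  obtain rfl := (hl n').mp h1
  rw [(hl _).mp hk]
  refine h2.resolve_left ?_
  rintro rfl
  obtain ⟨m', h3, -⟩ := h1.1
  simpa using h3.eq hm

end IsBundle

theorem UniqOrig.eq {t : Msg} {i : Fin B.size} (h : B.UniqOrig v b t i) {n : Fin B.size × ℕ}
    (hn : B.OriginatesAt v b t n) : n.1 = i := by
  obtain ⟨k, hk⟩ := h
  rw [(hk n).mp hn]

theorem UniqGen.eq {a : ℕ} {i : Fin B.size} (h : B.UniqGen v b a i) {n : Fin B.size × ℕ}
    (hn : B.GeneratesAt v b a n) : n.1 = i := by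
  obtain ⟨k, hk⟩ := h
  rw [(hk n).mp hn]

theorem UniqGen.strand_eq {a : ℕ} {i j : Fin B.size} (h : B.UniqGen v b a i)
    (h' : B.UniqGen v b a j) : i = j := by
  obtain ⟨k, hk⟩ := h
  exact h'.eq ((hk (i, k)).mpr rfl)

theorem HasEvent.of_le {n : Fin B.size × ℕ} {ev ev' : Event} (h : B.HasEvent v b n ev) {k : ℕ}
    (hk : k ≤ n.2) (h' : ((B.strand n.1).trace v b)[k]? = some ev') :
    B.HasEvent v b (n.1, k) ev' :=
  ⟨hk.trans_lt h.1, h'⟩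

theorem HasEvent.regular {n : Fin B.size × ℕ} {ev : Event} {r : Role} {e : Env}
    (h : B.HasEvent v b n ev) (hs : B.strand n.1 = .regular r e) :
    (roleTrace v b r e)[n.2]? = some ev := by
  have := h.2
  rwa [hs] at this

end Graph

/-! ### Penetrator steps, and what they cannot produce -/

/-- The messages that a penetrator strand can transmit after receiving messages satisfying `P`,
creating only atoms in `A` and random exponents in `X`. -/
inductive Derives (A : Atom → Prop) (X : ℕ → Prop) (P : Msg → Prop) : Msg → Prop
  | create {a : Atom} : A a → Derives A X P (.atom a)
  | createExpt {a : ℕ} : X a → Derives A X P (.expt (Expt.var a))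
  | one : Derives A X P (.expt 0)
  | generator : Derives A X P (.dh 0)
  | relay {m : Msg} : P m → Derives A X P m
  | concat {m n : Msg} : P m → P n → Derives A X P (m ⋆ n)
  | left {m n : Msg} : P (m ⋆ n) → Derives A X P m
  | right {m n : Msg} : P (m ⋆ n) → Derives A X P n
  | encrypt {p k : Msg} : P k → P p → Derives A X P (.enc p k)
  | decrypt {p k : Msg} : P k.inverse → P (.enc p k) → Derives A X P p
  | hash {m : Msg} : P m → Derives A X P (.hash m)
  | multiply {e f : Expt} : P (.expt e) → P (.expt f) → Derives A X P (.expt (e + f))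
  | invert {e : Expt} : P (.expt e) → Derives A X P (.expt (-e))
  | exponentiate {e f : Expt} : P (.dh e) → P (.expt f) → Derives A X P (.dh (e + f))

namespace Graph

variable {v : TLS} {b : Binding} {B : Graph}

theorem HasEvent.derives {n : Fin B.size × ℕ} {p : Penetrator} {m : Msg} {P : Msg → Prop}
    (hm : B.HasEvent v b n (.send m)) (hs : B.strand n.1 = .penetrator p)
    (hP : ∀ k < n.2, ∀ ev, B.HasEvent v b (n.1, k) ev → P ev.msg) :
    Derives (fun a => B.OriginatesAt v b (.atom a) n) (fun a => B.GeneratesAt v b a n) P m := by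
  obtain ⟨i, k⟩ := n
  have htr : (B.strand i).trace v b = p.trace := by rw [hs]; rfl
  have hk : p.trace[k]? = some (.send m) := htr ▸ hm.2
  have prior : ∀ l < k, ∀ ev, p.trace[l]? = some ev → P ev.msg := fun l hl ev hev =>
    hP l hl ev (hm.of_le hl.le (by rw [htr]; exact hev))
  have hlen : k < p.trace.length := by
    by_contra hcon
    rw [List.getElem?_eq_none (by omega)] at hk
    cases hk
  cases p <;> simp only [Penetrator.trace, List.length_cons, List.length_nil] at hlen hk prior
  case create a =>
    obtain rfl : k = 0 := by omega
    obtain rfl : Msg.atom a = m := by simpa using hk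
    exact .create ⟨⟨_, hm, rfl⟩, by simp⟩
  case createExpt a =>
    obtain rfl : k = 0 := by omega
    obtain rfl : Msg.expt (Expt.var a) = m := by simpa using hk
    exact .createExpt ⟨⟨_, hm, by simp [Msg.ExptOccurs, Expt.var]⟩, by simp⟩
  all_goals
    interval_cases k <;> simp only [List.getElem?_cons_zero, List.getElem?_cons_succ,
      Option.some.injEq, Event.send.injEq, reduceCtorEq] at hk <;> subst hk
  · exact .one
  · exact .generator
  · exact .relay (prior 0 (by omega) _ rfl)
  · exact .concat (prior 0 (by omega) _ rfl) (prior 1 (by omega) _ rfl)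
  · exact .left (prior 0 (by omega) _ rfl)
  · exact .right (prior 0 (by omega) _ rfl)
  · exact .encrypt (prior 0 (by omega) _ rfl) (prior 1 (by omega) _ rfl)
  · exact .decrypt (prior 0 (by omega) _ rfl) (prior 1 (by omega) _ rfl)
  · exact .hash (prior 0 (by omega) _ rfl)
  · exact .multiply (prior 0 (by omega) _ rfl) (prior 1 (by omega) _ rfl)
  · exact .invert (prior 0 (by omega) _ rfl)
  · exact .exponentiate (prior 0 (by omega) _ rfl) (prior 1 (by omega) _ rfl)

/-- An encryption under a key that never is a message of the bundle comes from a regular strand. -/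
theorem IsBundle.exists_regular_of_carries_enc (h : B.IsBundle v b) {p key : Msg}
    (hkey : ∀ n ev, B.HasEvent v b n ev → ev.msg ≠ key)
    {n : Fin B.size × ℕ} {ev : Event} (hev : B.HasEvent v b n ev)
    (hc : ev.msg.Carries (.enc p key)) :
    ∃ i k r e m, B.strand i = .regular r e ∧ B.HasEvent v b (i, k) (.send m) ∧
      (roleTrace v b r e)[k]? = some (.send m) ∧ m.Carries (.enc p key) ∧
      ((i, k) = n ∨ B.Precedes (i, k) n) := by
  obtain ⟨⟨i, k⟩, ⟨⟨m, hm, hmc⟩, hfirst⟩, hp⟩ :=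
    h.exists_first (fun m => m.Carries (.enc p key)) n ev hev hc
  cases hs : B.strand i with
  | regular r e => exact ⟨i, k, r, e, m, hs, hm, hm.regular hs, hmc, hp⟩
  | penetrator q =>
    -- Only an encryption step could make the penetrator the first to carry the ciphertext, and that
    -- step would have received `key`.
    have hd := hm.derives hs (P := fun m => ¬ m.Carries (.enc p key) ∧ m ≠ key)
      fun l hl ev hev => ⟨hfirst l hl ev hev, hkey _ _ hev⟩
    cases hd <;> simp_all [Msg.Carries]

/-- A hash that regular strands never transmit is only obtained by hashing its argument. -/
theorem IsBundle.not_carries_hash (h : B.IsBundle v b) {t : Msg}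
    (hreg : ∀ r e (k : ℕ) (m : Msg), (roleTrace v b r e)[k]? = some (.send m) → ¬ m.Carries (.hash t))
    (ht : ∀ n ev, B.HasEvent v b n ev → ev.msg ≠ t)
    {n : Fin B.size × ℕ} {ev : Event} (hev : B.HasEvent v b n ev) :
    ¬ ev.msg.Carries (.hash t) := by
  refine h.invariant (fun m => ¬ m.Carries (.hash t)) ?_ hev
  intro n m hm hfirst
  cases hs : B.strand n.1 with
  | regular r e => exact hreg r e n.2 m (hm.regular hs)
  | penetrator q =>
    have hd := hm.derives hs (P := fun m => ¬ m.Carries (.hash t) ∧ m ≠ t)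
      fun l hl ev hev => ⟨hfirst l hl ev hev, ht _ _ hev⟩
    cases hd <;> simp_all [Msg.Carries]
    exact fun h => by simp_all

end Graph

end UAF

/-! ### What regular strands transmit -/

namespace UAF

theorem lt_of_roleTrace {v : TLS} {b : Binding} {r : Role} {e : Env} {k : ℕ} {ev : Event}
    (h : (roleTrace v b r e)[k]? = some ev) : k < handshakeLength v + 2 := by
  have hk := (List.getElem?_eq_some_iff.mp h).1
  rwa [length_roleTrace] at hk

/-- Hashes under a label that regular strands transmit are verification data. -/
theorem tag_of_carries_hash {v : TLS} {b : Binding} {r : Role} {e : Env} {k : ℕ} {m t : Msg}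
    {g : Tag} (h : (roleTrace v b r e)[k]? = some (.send m))
    (hc : m.Carries (.hash (.tag g ⋆ t))) : g = .clientFinished ∨ g = .serverFinished := by
  have hk := lt_of_roleTrace h
  cases v <;> simp only [handshakeLength] at hk <;> cases r <;> interval_cases k <;>
    simp [roleTrace, handshake, registration, authentication, Flow.clientEvent,
      Flow.serverEvent] at h <;> subst h <;>
    simp [Msg.Carries, serverFlight12, certificate, clientKeyExchange12, clientFinished12,
      serverFinished12, certificateVerify13, clientFinished13, serverFinished13, hellos13,
      keyHandle, finalChallenge, regAssertion, authAssertion] at hc <;>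
    simp [hc]

/-- Regular strands transmit no exponents. -/
theorem not_carries_expt {v : TLS} {b : Binding} {r : Role} {e : Env} {k : ℕ} {m : Msg}
    {f : Expt} (h : (roleTrace v b r e)[k]? = some (.send m)) : ¬ m.Carries (.expt f) := by
  intro hc
  have hk := lt_of_roleTrace h
  cases v <;> simp only [handshakeLength] at hk <;> cases r <;> interval_cases k <;>
    simp [roleTrace, handshake, registration, authentication, Flow.clientEvent,
      Flow.serverEvent] at h <;> subst h <;>
    simp [Msg.Carries, serverFlight12, certificate, clientKeyExchange12, clientFinished12,
      serverFinished12, certificateVerify13, clientFinished13, serverFinished13, hellos13,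
      keyHandle, finalChallenge, regAssertion, authAssertion] at hc

/-- The group elements that regular strands transmit are their own shares. -/
theorem share_of_carries_dh {v : TLS} {b : Binding} {r : Role} {e : Env} {k : ℕ} {m : Msg}
    {f : Expt} (h : (roleTrace v b r e)[k]? = some (.send m)) (hc : m.Carries (.dh f)) :
    v.IsDH ∧ (r.IsClient ∧ f = e.x ∨ r.IsServer ∧ f = e.y) := by
  have hk := lt_of_roleTrace h
  cases v <;> simp only [handshakeLength] at hk <;> cases r <;> interval_cases k <;>
    simp [roleTrace, handshake, registration, authentication, Flow.clientEvent,
      Flow.serverEvent] at h <;> subst h <;>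
    simp [Msg.Carries, serverFlight12, certificate, clientKeyExchange12, clientFinished12,
      serverFinished12, certificateVerify13, clientFinished13, serverFinished13, hellos13,
      keyHandle, finalChallenge, regAssertion, authAssertion] at hc <;>
    simp [hc, TLS.IsDH, Role.IsClient, Role.IsServer]

/-- `m.Guarded t key`: `m` carries the atom `t` only inside encryptions under `key`. -/
def Msg.Guarded : Msg → Msg → Msg → Prop
  | .atom a, t, _ => .atom a ≠ t
  | .expt _, _, _ => True
  | .dh _, _, _ => True
  | .pair m n, t, key => m.Guarded t key ∧ n.Guarded t key
  | .enc p k, t, key => k = key ∨ p.Guarded t key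
  | .hash _, _, _ => True

/-- Regular strands transmit premaster secrets only in the client's key exchange message. -/
theorem guarded_of_regular {v : TLS} {b : Binding} {r : Role} {e : Env} {k : ℕ} {m key : Msg}
    {pms : ℕ} (h : (roleTrace v b r e)[k]? = some (.send m)) :
    m.Guarded (.random48 pms) key ∨
      v = .rsa12 ∧ r.IsClient ∧ k = 2 ∧ e.pms = pms ∧ m = clientKeyExchange12 v e := by
  have hk := lt_of_roleTrace h
  cases v <;> simp only [handshakeLength] at hk <;> cases r <;> interval_cases k <;>
    simp [roleTrace, handshake, registration, authentication, Flow.clientEvent,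
      Flow.serverEvent] at h <;> subst h <;>
    simp [Msg.Guarded, serverFlight12, certificate, clientKeyExchange12, clientFinished12,
      serverFinished12, certificateVerify13, clientFinished13, serverFinished13, hellos13,
      keyHandle, finalChallenge, regAssertion, authAssertion, Role.IsClient] <;> tauto

/-- The last clause, that the first message carries no other random, is what lets a server random
different from the client random originate in the second message. -/
theorem carries_clientRandom {v : TLS} {b : Binding} {r : Role} {e : Env} {ev : Event}
    (h : (roleTrace v b r e)[0]? = some ev) :
    (r.IsClient → ∃ m, ev = .send m ∧ m.Carries (.random32 e.cr)) ∧
    (r.IsServer → ∃ m, ev = .recv m ∧ m.Carries (.random32 e.cr)) ∧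
    ∀ c, ev.msg.Carries (.random32 c) → c = e.cr := by
  cases v <;> cases r <;>
    simp [roleTrace, handshake, Flow.clientEvent, Flow.serverEvent] at h <;> subst h <;>
    simp [Msg.Carries, Event.msg, Role.IsClient, Role.IsServer]

theorem carries_serverRandom {v : TLS} {b : Binding} {r : Role} {e : Env} {ev : Event}
    (h : (roleTrace v b r e)[1]? = some ev) :
    (r.IsClient → ∃ m, ev = .recv m ∧ m.Carries (.random32 e.sr)) ∧
    (r.IsServer → ∃ m, ev = .send m ∧ m.Carries (.random32 e.sr)) := by
  cases v <;> cases r <;>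
    simp [roleTrace, handshake, Flow.clientEvent, Flow.serverEvent] at h <;> subst h <;>
    simp [Msg.Carries, Role.IsClient, Role.IsServer, serverFlight12]

/-! ### Origination of the randoms and secrecy of the premaster secret -/

namespace Graph

variable {v : TLS} {b : Binding} {B : Graph}

theorem exists_hasEvent (hB : B.IsBundle v b) {i : Fin B.size} {r : Role} {e : Env}
    (hs : B.strand i = .regular r e) {k : ℕ} (hk : k < B.height i) :
    ∃ ev, B.HasEvent v b (i, k) ev ∧ (roleTrace v b r e)[k]? = some ev := by
  have hlen := hB.height_le i
  have hl : k < ((B.strand i).trace v b).length := by omega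
  have hev : B.HasEvent v b (i, k) (((B.strand i).trace v b)[k]) :=
    ⟨hk, List.getElem?_eq_getElem hl⟩
  exact ⟨_, hev, hev.regular hs⟩

theorem hasEvent_of_roleTrace {i : Fin B.size} {r : Role} {e : Env}
    (hs : B.strand i = .regular r e) {k : ℕ} (hk : k < B.height i) {ev : Event}
    (h : (roleTrace v b r e)[k]? = some ev) : B.HasEvent v b (i, k) ev :=
  ⟨hk, by rw [hs]; exact h⟩

theorem originatesAt_clientRandom (hB : B.IsBundle v b) {i : Fin B.size} {r : Role} {e : Env}
    (hs : B.strand i = .regular r e) (hr : r.IsClient) :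
    B.OriginatesAt v b (.random32 e.cr) (i, 0) := by
  obtain ⟨ev, h1, h2⟩ := exists_hasEvent hB hs (hB.height_pos i)
  obtain ⟨m, rfl, hm⟩ := (carries_clientRandom h2).1 hr
  exact ⟨⟨m, h1, hm⟩, by simp⟩

theorem originatesAt_serverRandom (hB : B.IsBundle v b) {i : Fin B.size} {r : Role} {e : Env}
    (hs : B.strand i = .regular r e) (hr : r.IsServer) (hi : 2 ≤ B.height i)
    (hne : e.cr ≠ e.sr) : B.OriginatesAt v b (.random32 e.sr) (i, 1) := by
  obtain ⟨ev, h1, h2⟩ := exists_hasEvent hB hs (k := 1) (by omega)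
  obtain ⟨m, rfl, hm⟩ := (carries_serverRandom h2).2 hr
  refine ⟨⟨m, h1, hm⟩, ?_⟩
  intro k hk ev hev hc
  obtain rfl : k = 0 := by simp at hk; exact hk
  exact hne ((carries_clientRandom (hev.regular hs)).2.2 _ hc).symm

/-- Client strands with the same fresh client random coincide. -/
theorem eq_of_clientRandom (hB : B.IsBundle v b) {s i : Fin B.size} {c : ℕ} {r : Role} {e : Env}
    (hc : B.UniqOrig v b (.random32 c) s) (hs : B.strand i = .regular r e) (hr : r.IsClient)
    (he : e.cr = c) : i = s :=
  hc.eq (he ▸ originatesAt_clientRandom hB hs hr)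

/-- Without the decryption key, a fresh premaster secret stays inside the key exchange message. -/
theorem guarded_premaster (hB : B.IsBundle .rsa12 b) {s : Fin B.size} {e : Env} {r : Role}
    (hs : B.strand s = .regular r e)
    (hpriv : B.NonOrig .rsa12 b (.priv (.longTerm e.server)))
    (hpms : B.UniqOrig .rsa12 b (.random48 e.pms) s)
    {n : Fin B.size × ℕ} {ev : Event} (hev : B.HasEvent .rsa12 b n ev) :
    ev.msg.Guarded (.random48 e.pms) (.pub (.longTerm e.server)) := by
  refine hB.invariant
    (fun m => m.Guarded (.random48 e.pms) (.pub (.longTerm e.server))) ?_ hev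
  intro n m hm hfirst
  cases hn : B.strand n.1 with
  | regular r' e' =>
    rcases guarded_of_regular (hm.regular hn) (key := .pub (.longTerm e.server))
      (pms := e.pms) with hg | ⟨-, hr, hk, he, rfl⟩
    · exact hg
    -- Another client using the same premaster secret might encrypt it for a different server.
    -- Unique origination excludes this, because the secret would originate there too.
    · have ho : B.OriginatesAt .rsa12 b (.random48 e.pms) n := by
        refine ⟨⟨_, hm, by simp [clientKeyExchange12, Msg.Carries, he]⟩, ?_⟩
        intro k hk' ev hev hc
        have hev := hev.regular hn
        obtain ⟨i, l⟩ := n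
        simp only at hk hk'
        subst hk
        cases r' <;> simp only [Role.IsClient] at hr <;>
        interval_cases k <;> simp [roleTrace, handshake, Flow.clientEvent] at hev <;>
          subst hev <;> simp [Event.msg, Msg.Carries, serverFlight12, certificate] at hc
      have := hpms.eq ho
      rw [this, hs] at hn
      obtain ⟨rfl, rfl⟩ : r = r' ∧ e = e' := by simpa using hn
      simp [clientKeyExchange12, Msg.Guarded, serverKey]
  | penetrator q =>
    have hd := hm.derives hn (P := fun m => m.Guarded (.random48 e.pms)
      (.pub (.longTerm e.server)) ∧ ¬ m.Carries (.priv (.longTerm e.server)))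
      fun l hl ev hev => ⟨hfirst l hl ev hev, hpriv _ _ hev⟩
    cases hd with
    | create ha =>
      intro heq
      rw [heq] at ha
      have := hpms.eq ha
      rw [this, hs] at hn
      cases hn
    | decrypt hk hp =>
      -- If the stripped encryption is the guarding one, the penetrator has received the server's
      -- private key.
      rcases hp.1 with rfl | hp
      · exact absurd rfl hk.2
      · exact hp
    | _ => simp_all [Msg.Guarded]

/-! ### Secrecy of the shared Diffie–Hellman value -/

/-- The random exponents generated uniquely, and by a regular strand. -/
def FreshExpt (v : TLS) (b : Binding) (B : Graph) (u : ℕ) : Prop :=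
  ∃ i r e, B.strand i = .regular r e ∧ B.UniqGen v b u i

theorem FreshExpt.not_generatesAt {u : ℕ} (hu : B.FreshExpt v b u) {n : Fin B.size × ℕ}
    {p : Penetrator} (hn : B.strand n.1 = .penetrator p) : ¬ B.GeneratesAt v b u n := by
  rintro hg
  obtain ⟨i, r, e, h1, h2⟩ := hu
  rw [h2.eq hg, h1] at hn
  cases hn

/-- Fresh exponents do not occur in exponents that are messages, and at most one of them
occurs in the exponent of a group element. -/
def DHSafe (v : TLS) (b : Binding) (B : Graph) : Msg → Prop
  | .atom _ => True
  | .expt e => ∀ u, B.FreshExpt v b u → e u = 0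
  | .dh e => ∃ u₀, ∀ u, B.FreshExpt v b u → u ≠ u₀ → e u = 0
  | .pair m n => DHSafe v b B m ∧ DHSafe v b B n
  | .enc p _ => DHSafe v b B p
  | .hash _ => True

/-- Meant for regular transmissions: they carry no exponents, and their only group elements are the
strand's own share. Shares of the peer occur only under hashes or in keys, which are not inspected.
-/
theorem dhSafe_of_carries {m : Msg} (h1 : ∀ f, ¬ m.Carries (.expt f))
    (h2 : ∀ f, m.Carries (.dh f) → ∃ c, f = Expt.var c) : B.DHSafe v b m := by
  induction m with
  | atom a => trivial
  | expt f => exact absurd rfl (h1 f)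
  | dh f =>
    obtain ⟨c, rfl⟩ := h2 f rfl
    exact ⟨c, fun u _ hu => by simp [Expt.var, Ne.symm hu]⟩
  | pair m n hm hn =>
    exact ⟨hm (fun f hf => h1 f (.inr (.inl hf))) fun f hf => h2 f (.inr (.inl hf)),
      hn (fun f hf => h1 f (.inr (.inr hf))) fun f hf => h2 f (.inr (.inr hf))⟩
  | enc p k hp _ =>
    exact hp (fun f hf => h1 f (.inr hf)) fun f hf => h2 f (.inr hf)
  | hash m _ => trivial

/-- The penetrator cannot create a fresh exponent, and the exponents it obtains form a set closed
under products and inverses in which no fresh exponent occurs. Exponentiation therefore never brings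
a second fresh exponent into a group element. -/
theorem dhSafe (hB : B.InSpace v b) {n : Fin B.size × ℕ} {ev : Event}
    (hev : B.HasEvent v b n ev) : B.DHSafe v b ev.msg := by
  refine hB.isBundle.invariant _ ?_ hev
  intro n m hm hfirst
  cases hn : B.strand n.1 with
  | regular r e =>
    refine dhSafe_of_carries (fun f => not_carries_expt (hm.regular hn)) fun f hf => ?_
    obtain ⟨hv, ⟨hr, rfl⟩ | ⟨hr, rfl⟩⟩ := share_of_carries_dh (hm.regular hn) hf
    · exact (hB.wellSorted _ _ _ hn hv).1 hr
    · exact (hB.wellSorted _ _ _ hn hv).2 hr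
  | penetrator q =>
    have hd := hm.derives hn hfirst
    cases hd with
    | create ha => trivial
    | @createExpt a ha =>
      intro u hu
      rcases eq_or_ne u a with rfl | hne
      · exact absurd ha (hu.not_generatesAt hn)
      · simp [Expt.var, hne.symm]
    | one => exact fun u _ => rfl
    | generator => exact ⟨0, fun u _ _ => rfl⟩
    | relay h => exact h
    | concat h h' => exact ⟨h, h'⟩
    | left h => exact h.1
    | right h => exact h.2
    | encrypt h h' => exact h'
    | decrypt h h' => exact h'
    | hash h => trivial
    | multiply h h' => exact fun u hu => by simp [h u hu, h' u hu]
    | invert h => exact fun u hu => by simp [h u hu]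
    | exponentiate h h' =>
      obtain ⟨u₀, h⟩ := h
      exact ⟨u₀, fun u hu hne => by simp [h u hu hne, h' u hu]⟩

theorem DHSafe.of_carries {m t : Msg} (h : B.DHSafe v b m) (hc : m.Carries t) :
    B.DHSafe v b t := by
  induction m with
  | atom a => obtain rfl := hc; exact h
  | expt f => obtain rfl := hc; exact h
  | dh f => obtain rfl := hc; exact h
  | pair m n hm hn =>
    rcases hc with rfl | hc | hc
    · exact h
    · exact hm h.1 hc
    · exact hn h.2 hc
  | enc p k hp _ =>
    rcases hc with rfl | hc
    · exact h
    · exact hp h hc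
  | hash m _ => obtain rfl := hc; exact h

/-- The shared group element of two fresh exponents stays secret. -/
theorem not_carries_shared (hB : B.InSpace v b) {a c : ℕ} (ha : B.FreshExpt v b a)
    (hc : B.FreshExpt v b c) (hne : a ≠ c) {n : Fin B.size × ℕ} {ev : Event}
    (hev : B.HasEvent v b n ev) : ¬ ev.msg.Carries (.dh (Expt.var a + Expt.var c)) := by
  intro hcar
  obtain ⟨u₀, h⟩ := (dhSafe hB hev).of_carries hcar
  -- Both `a` and `c` have coefficient 1, so each would have to be the one exceptional index `u₀`.
  have h1 := h a ha
  have h2 := h c hc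
  simp [Expt.var, hne, hne.symm] at h1 h2
  exact hne (h1.trans h2.symm)

end Graph

end UAF

/-! ### Recognizing the sender of a protected message -/

namespace UAF

theorem Msg.carries_self (m : Msg) : m.Carries m := by
  cases m <;> simp [Msg.Carries]

theorem Msg.Carries.fst {m n t : Msg} (h : m.Carries t) : (m ⋆ n).Carries t :=
  .inr (.inl h)

theorem Msg.Carries.snd {m n t : Msg} (h : n.Carries t) : (m ⋆ n).Carries t :=
  .inr (.inr h)

section Traces

variable {v : TLS} {b : Binding} {r : Role} {e e' : Env} {k : ℕ} {m : Msg}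

/-- The label inside the verification data fixes role and position, so the encryption key may be
arbitrary. Agreement on the values is read off later by injectivity of hashing. -/
theorem regular_clientFinished12 (hv : v ≠ .tls13) {key : Msg}
    (h : (roleTrace v b r e')[k]? = some (.send m))
    (hc : m.Carries (.enc (clientFinished12 v e) key)) :
    r.IsClient ∧ k = 3 ∧ clientFinished12 v e' = clientFinished12 v e := by
  have hk := lt_of_roleTrace h
  cases v <;> simp only [ne_eq, not_true_eq_false] at hv <;>
    simp only [handshakeLength] at hk <;> cases r <;> interval_cases k <;>
    simp [roleTrace, handshake, registration, authentication, Flow.clientEvent,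
      Flow.serverEvent] at h <;> subst h <;>
    simp [Msg.Carries, serverFlight12, certificate, clientKeyExchange12,
      keyHandle, finalChallenge, regAssertion, authAssertion, clientFinished12,
      serverFinished12] at hc <;>
    simp [hc, Role.IsClient, clientFinished12]

theorem regular_serverFinished12 (hv : v ≠ .tls13) {key : Msg}
    (h : (roleTrace v b r e')[k]? = some (.send m))
    (hc : m.Carries (.enc (serverFinished12 v e) key)) :
    r.IsServer ∧ k = 4 ∧ serverFinished12 v e' = serverFinished12 v e := by
  have hk := lt_of_roleTrace h
  cases v <;> simp only [ne_eq, not_true_eq_false] at hv <;>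
    simp only [handshakeLength] at hk <;> cases r <;> interval_cases k <;>
    simp [roleTrace, handshake, registration, authentication, Flow.clientEvent,
      Flow.serverEvent] at h <;> subst h <;>
    simp [Msg.Carries, serverFlight12, certificate, clientKeyExchange12,
      keyHandle, finalChallenge, regAssertion, authAssertion, clientFinished12,
      serverFinished12] at hc <;>
    simp [hc, Role.IsClient, Role.IsServer, serverFinished12, clientFinished12]

/-- Two randoms followed by a group element form a plaintext that occurs in no other encryption or
signature of the model. -/
theorem regular_keyExchangeSignature
    (h : (roleTrace .dh12 b r e')[k]? = some (.send m))
    (hc : m.Carries (.enc (.random32 e.cr ⋆ .random32 e.sr ⋆ .dh e.y)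
      (.priv (serverKey .dh12 e)))) :
    r.IsServer ∧ k = 1 ∧ e'.y = e.y := by
  have hk := lt_of_roleTrace h
  simp only [handshakeLength] at hk
  cases r <;> interval_cases k <;>
    simp [roleTrace, handshake, registration, authentication, Flow.clientEvent,
      Flow.serverEvent] at h <;> subst h <;>
    simp [Msg.Carries, serverFlight12, certificate, clientKeyExchange12,
      keyHandle, finalChallenge, regAssertion, authAssertion, clientFinished12,
      serverFinished12] at hc <;>
    simp [hc, Role.IsClient, Role.IsServer]

theorem regular_certificateVerify13
    (h : (roleTrace .tls13 b r e')[k]? = some (.send m))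
    (hc : m.Carries (certificateVerify13 e)) :
    r.IsServer ∧ k = 2 ∧ e'.y = e.y := by
  have hk := lt_of_roleTrace h
  simp only [handshakeLength] at hk
  cases r <;> interval_cases k <;>
    simp [roleTrace, handshake, registration, authentication, Flow.clientEvent,
      Flow.serverEvent] at h <;> subst h <;>
    simp [Msg.Carries, certificate, certificateVerify13, hellos13, serverFinished13,
      keyHandle, finalChallenge, regAssertion, authAssertion, clientFinished13] at hc <;>
    simp [hc, Role.IsClient, Role.IsServer]

/-- Here the plaintext is arbitrary: the label in the handshake key separates it from every other
key, and the key itself hashes the hellos. -/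
theorem regular_serverFlight13 {p : Msg}
    (h : (roleTrace .tls13 b r e')[k]? = some (.send m))
    (hc : m.Carries (.enc p (handshakeKey13 e .serverHandshake))) :
    r.IsServer ∧ k = 2 ∧ hellos13 e' = hellos13 e := by
  have hk := lt_of_roleTrace h
  simp only [handshakeLength] at hk
  cases r <;> interval_cases k <;>
    simp [roleTrace, handshake, registration, authentication, Flow.clientEvent,
      Flow.serverEvent] at h <;> subst h <;>
    simp [Msg.Carries, certificate, certificateVerify13, serverFinished13, handshakeKey13,
      keyHandle, finalChallenge, regAssertion, authAssertion, clientFinished13, hellos13,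
      swk, cwk, writeKey] at hc <;>
    simp [hc, Role.IsClient, Role.IsServer, hellos13]

theorem regular_clientFinished13 {p : Msg}
    (h : (roleTrace .tls13 b r e')[k]? = some (.send m))
    (hc : m.Carries (.enc p (handshakeKey13 e .clientHandshake))) :
    r.IsClient ∧ k = 3 ∧ hellos13 e' = hellos13 e := by
  have hk := lt_of_roleTrace h
  simp only [handshakeLength] at hk
  cases r <;> interval_cases k <;>
    simp [roleTrace, handshake, registration, authentication, Flow.clientEvent,
      Flow.serverEvent] at h <;> subst h <;>
    simp [Msg.Carries, certificate, certificateVerify13, serverFinished13, handshakeKey13,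
      keyHandle, finalChallenge, regAssertion, authAssertion, clientFinished13, hellos13,
      swk, cwk, writeKey] at hc <;>
    simp [hc, Role.IsClient, hellos13]

/-- The two leading names separate this message from the authentication challenge, which has only
one. -/
theorem regular_challenge
    (h : (roleTrace v b r e')[k]? = some (.send m))
    (hc : m.Carries (.enc (.name e.username ⋆ .name e.appid ⋆ .text e.challenge) (swk v e))) :
    r = .serverReg ∧ k = handshakeLength v ∧ e'.username = e.username ∧ e'.appid = e.appid ∧
      e'.challenge = e.challenge ∧ swk v e' = swk v e := by
  have hk := lt_of_roleTrace h
  cases v <;>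
    simp only [handshakeLength] at hk <;> cases r <;> interval_cases k <;>
    simp [roleTrace, handshake, registration, authentication, Flow.clientEvent,
      Flow.serverEvent] at h <;> subst h <;>
    simp [Msg.Carries, serverFlight12, certificate, clientKeyExchange12,
      keyHandle, finalChallenge, regAssertion, authAssertion, clientFinished12,
      serverFinished12, certificateVerify13, serverFinished13, clientFinished13] at hc <;>
    simp [hc, handshakeLength]

end Traces

/-! ### Agreement on a session -/

/-- The two instances agree on the variables of their TLS session and of the server's messages up
to the challenge. -/
structure SameSession (v : TLS) (e e' : Env) : Prop where
  username : e'.username = e.username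
  appid : e'.appid = e.appid
  challenge : e'.challenge = e.challenge
  server : e'.server = e.server
  ca : e'.ca = e.ca
  cr : e'.cr = e.cr
  sr : e'.sr = e.sr
  pms : v = .rsa12 → e'.pms = e.pms
  x : v ≠ .rsa12 → e'.x = e.x
  y : v ≠ .rsa12 → e'.y = e.y
  spk : v = .tls13 → e'.spk = e.spk

theorem SameSession.regContext {v : TLS} {e e' : Env} (h : SameSession v e e') :
    regContext v (.clientReg, e) (.serverReg, e') := by
  obtain ⟨h1, h2, h3, h4, h5, h6, h7, h8, h9, h10, h11⟩ := h
  intro z hz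
  cases v <;> simp [tlsContextVars] at hz <;> rcases hz with rfl | hz <;>
    simp_all [Agree, value] <;> aesop

/-- The bound on `k` leaves out the client's final message, which depends on the authenticator and
on its key, values outside the session. -/
theorem SameSession.flow_eq {v : TLS} {e e' : Env} (h : SameSession v e e') (b : Binding) {k : ℕ}
    (hk : k < handshakeLength v + 1) :
    (handshake v e' ++ registration v b e')[k]? = (handshake v e ++ registration v b e)[k]? := by
  obtain ⟨h1, h2, h3, h4, h5, h6, h7, h8, h9, h10, h11⟩ := h
  cases v <;> simp only [handshakeLength] at hk <;> interval_cases k <;>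
    simp_all [handshake, registration, serverFlight12, clientKeyExchange12, certificate,
      serverKey, clientFinished12, serverFinished12, transcript12, masterSecret, dhShared,
      swk, cwk, writeKey, certificateVerify13, hellos13, serverFinished13, handshakeKey13,
      handshakeSecret, clientFinished13, transcript13]

/-! ### Secrecy of derived keys -/

namespace Graph

variable {v : TLS} {b : Binding} {B : Graph}

theorem IsBundle.exists_regular_of_recv (h : B.IsBundle v b) {p key : Msg}
    (hkey : ∀ n ev, B.HasEvent v b n ev → ¬ ev.msg.Carries key)
    {n : Fin B.size × ℕ} {m : Msg} (hm : B.HasEvent v b n (.recv m))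
    (hc : m.Carries (.enc p key)) :
    ∃ i k r e m', B.strand i = .regular r e ∧ k < B.height i ∧
      (roleTrace v b r e)[k]? = some (.send m') ∧ m'.Carries (.enc p key) ∧
      B.Precedes (i, k) n := by
  obtain ⟨i, k, r, e, m', h1, h2, h3, h4, h5⟩ := h.exists_regular_of_carries_enc
    (fun n ev hev heq => hkey n ev hev (by rw [heq]; exact key.carries_self)) hm hc
  refine ⟨i, k, r, e, m', h1, h2.1, h3, h4, h5.resolve_left ?_⟩
  rintro rfl
  simpa using h2.eq hm

/-- A key derived from a secret is secret. -/
theorem not_carries_derived (hB : B.IsBundle v b) {g : Tag} {t : Msg}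
    (hg : g ≠ .clientFinished ∧ g ≠ .serverFinished) (u : Msg) (hu : t.Carries u)
    (ht : ∀ n ev, B.HasEvent v b n ev → ¬ ev.msg.Carries u)
    {n : Fin B.size × ℕ} {ev : Event} (hev : B.HasEvent v b n ev) :
    ¬ ev.msg.Carries (.hash (.tag g ⋆ t)) := by
  refine hB.not_carries_hash ?_ ?_ hev
  · intro r e k m h hc
    rcases tag_of_carries_hash h hc with rfl | rfl
    · exact hg.1 rfl
    · exact hg.2 rfl
  · intro n ev hev heq
    exact ht n ev hev (heq ▸ hu.snd)

theorem not_carries_writeKey (hB : B.IsBundle v b) {e : Env}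
    (hms : ∀ n ev, B.HasEvent v b n ev → ¬ ev.msg.Carries (masterSecret v e))
    {g : Tag} (hg : g ≠ .clientFinished ∧ g ≠ .serverFinished)
    (n : Fin B.size × ℕ) (ev : Event) (hev : B.HasEvent v b n ev) :
    ¬ ev.msg.Carries (writeKey v e g) := by
  cases v <;>
    exact not_carries_derived hB hg _ (Msg.Carries.fst (Msg.carries_self _)) hms hev

/-- Hashing to the master secret requires its argument as a message, and that argument carries the
premaster secret unguarded. -/
theorem not_carries_masterSecret_rsa12 (hB : B.IsBundle .rsa12 b) {s : Fin B.size} {e : Env}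
    {r : Role} (hs : B.strand s = .regular r e)
    (hpriv : B.NonOrig .rsa12 b (.priv (.longTerm e.server)))
    (hpms : B.UniqOrig .rsa12 b (.random48 e.pms) s)
    (n : Fin B.size × ℕ) (ev : Event) (hev : B.HasEvent .rsa12 b n ev) :
    ¬ ev.msg.Carries (masterSecret .rsa12 e) := by
  refine hB.not_carries_hash ?_ ?_ hev
  · intro r e k m h hc
    simpa using tag_of_carries_hash h hc
  · intro n ev hev heq
    have := guarded_premaster hB hs hpriv hpms hev
    rw [heq] at this
    simp [Msg.Guarded] at this

/-- The shared value of a client and a server strand that both use fresh exponents is secret. -/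
theorem not_carries_dhShared (hB : B.InSpace v b) (hv : v.IsDH) {s t : Fin B.size} {e e' : Env}
    {r r' : Role} (hs : B.strand s = .regular r e) (hr : r.IsClient)
    {a : ℕ} (hx : e.x = Expt.var a) (ha : B.UniqGen v b a s)
    (ht : B.strand t = .regular r' e') (hr' : r'.IsServer) (h2 : 2 ≤ B.height t)
    (hy : e'.y = e.y) :
    (∃ c, e.y = Expt.var c ∧ a ≠ c) ∧
    ∀ n ev, B.HasEvent v b n ev → ¬ ev.msg.Carries (dhShared e) := by
  obtain ⟨c, hc⟩ := (hB.wellSorted _ _ _ ht hv).2 hr'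
  have hcg := hB.server_fresh hv t r' e' c ht hr' h2 hc
  -- Equal exponents would be uniquely generated on one strand, which would then be both client and
  -- server.
  have hne : a ≠ c := by
    rintro rfl
    obtain rfl := ha.strand_eq hcg
    rw [hs] at ht
    obtain ⟨rfl, -⟩ : r = r' ∧ e = e' := by simpa using ht
    exact hr' hr
  refine ⟨⟨c, hy ▸ hc, hne⟩, ?_⟩
  intro n ev hev
  have := not_carries_shared hB ⟨s, r, e, hs, ha⟩ ⟨t, r', e', ht, hcg⟩ hne hev
  rwa [← hx, ← hc, hy] at this

/-! ### What a client can conclude -/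

/-- A full client-reg strand under the client assumptions. -/
structure ClientSession (v : TLS) (b : Binding) (B : Graph) (s : Fin B.size) (e : Env) :
    Prop where
  inSpace : B.InSpace v b
  strand : B.strand s = .regular .clientReg e
  height : roleHeight v .clientReg ≤ B.height s
  assumptions : clientAssumptions v b B s e

namespace ClientSession

variable {s : Fin B.size} {e : Env}

theorem isBundle (h : ClientSession v b B s e) : B.IsBundle v b := h.inSpace.isBundle

theorem uniqOrig_cr (h : ClientSession v b B s e) : B.UniqOrig v b (.random32 e.cr) s :=
  h.assumptions.2.2.2.1

theorem hasEvent (h : ClientSession v b B s e) {k : ℕ} {ev : Event}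
    (hk : (roleTrace v b .clientReg e)[k]? = some ev) : B.HasEvent v b (s, k) ev :=
  hasEvent_of_roleTrace h.strand ((lt_of_roleTrace hk).trans_le h.height) hk

/-- The server signed its exponent, which therefore is fresh. -/
theorem shared_dh12 (h : ClientSession .dh12 b B s e) {a : ℕ} (hx : e.x = Expt.var a)
    (ha : B.UniqGen .dh12 b a s) :
    (∃ c, e.y = Expt.var c ∧ a ≠ c) ∧
    ∀ n ev, B.HasEvent .dh12 b n ev → ¬ ev.msg.Carries (dhShared e) := by
  have hev : B.HasEvent .dh12 b (s, 1) (.recv (serverFlight12 .dh12 e)) := h.hasEvent rfl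
  obtain ⟨i, k, r, e', m, hi, hk, htr, hc, -⟩ :=
    h.isBundle.exists_regular_of_recv h.assumptions.2.1 hev
      (p := .random32 e.cr ⋆ .random32 e.sr ⋆ .dh e.y) (by simp [serverFlight12, Msg.Carries])
  obtain ⟨hr, rfl, hy⟩ := regular_keyExchangeSignature htr hc
  exact not_carries_dhShared h.inSpace trivial h.strand trivial hx ha hi hr hk hy

/-- The server's exponent is authenticated by CertificateVerify, whose signature covers the hashed
hellos. Secrecy of the handshake key around it is not needed, so there is no circularity. -/
theorem shared_tls13 (h : ClientSession .tls13 b B s e) {a : ℕ} (hx : e.x = Expt.var a)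
    (ha : B.UniqGen .tls13 b a s) :
    (∃ c, e.y = Expt.var c ∧ a ≠ c) ∧
    ∀ n ev, B.HasEvent .tls13 b n ev → ¬ ev.msg.Carries (dhShared e) := by
  have hev : B.HasEvent .tls13 b (s, 2) (.recv (.enc
      (certificate .tls13 e ⋆ certificateVerify13 e ⋆ serverFinished13 e)
        (handshakeKey13 e .serverHandshake))) := h.hasEvent rfl
  obtain ⟨i, k, r, e', m, hi, hk, htr, hc, -⟩ :=
    h.isBundle.exists_regular_of_recv h.assumptions.2.1 hev
      (p := .tag .certificateVerify ⋆ .hash (hellos13 e ⋆ certificate .tls13 e))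
      (by simp [certificateVerify13, Msg.Carries, serverKey])
  obtain ⟨hr, rfl, hy⟩ := regular_certificateVerify13 htr hc
  exact not_carries_dhShared h.inSpace trivial h.strand trivial hx ha hi hr (by omega) hy

theorem not_carries_handshakeSecret (h : ClientSession .tls13 b B s e)
    (n : Fin B.size × ℕ) (ev : Event) (hev : B.HasEvent .tls13 b n ev) :
    ¬ ev.msg.Carries (handshakeSecret e) := by
  obtain ⟨a, hx, ha⟩ := h.assumptions.2.2.2.2
  exact not_carries_derived h.isBundle (by simp) _ (Msg.carries_self _)
    (h.shared_tls13 hx ha).2 hev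

theorem not_carries_handshakeKey (h : ClientSession .tls13 b B s e) {g : Tag}
    (hg : g ≠ .clientFinished ∧ g ≠ .serverFinished)
    (n : Fin B.size × ℕ) (ev : Event) (hev : B.HasEvent .tls13 b n ev) :
    ¬ ev.msg.Carries (handshakeKey13 e g) :=
  not_carries_derived h.isBundle hg _ (Msg.Carries.fst (Msg.carries_self _))
    h.not_carries_handshakeSecret hev

theorem not_carries_masterSecret (h : ClientSession v b B s e)
    (n : Fin B.size × ℕ) (ev : Event) (hev : B.HasEvent v b n ev) :
    ¬ ev.msg.Carries (masterSecret v e) := by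
  cases v with
  | rsa12 =>
    exact not_carries_masterSecret_rsa12 h.isBundle h.strand h.assumptions.2.1
      h.assumptions.2.2.2.2 n ev hev
  | dh12 =>
    obtain ⟨a, hx, ha⟩ := h.assumptions.2.2.2.2
    exact not_carries_derived h.isBundle (by simp) _ (Msg.Carries.fst (Msg.carries_self _))
      (h.shared_dh12 hx ha).2 hev
  | tls13 =>
    exact not_carries_derived h.isBundle (by simp) _ (Msg.carries_self _)
      h.not_carries_handshakeSecret hev

theorem not_carries_swk (h : ClientSession v b B s e) :
    ∀ n ev, B.HasEvent v b n ev → ¬ ev.msg.Carries (swk v e) :=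
  not_carries_writeKey h.isBundle h.not_carries_masterSecret (by simp)

theorem not_carries_cwk (h : ClientSession v b B s e) :
    ∀ n ev, B.HasEvent v b n ev → ¬ ev.msg.Carries (cwk v e) :=
  not_carries_writeKey h.isBundle h.not_carries_masterSecret (by simp)

/-- The challenge comes from a server-reg strand. -/
theorem exists_challenger (h : ClientSession v b B s e) {n : Fin B.size × ℕ}
    (hn : B.HasEvent v b n
      (.recv (.enc (.name e.username ⋆ .name e.appid ⋆ .text e.challenge) (swk v e)))) :
    ∃ i e', B.strand i = .regular .serverReg e' ∧ handshakeLength v + 1 ≤ B.height i ∧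
      e'.username = e.username ∧ e'.appid = e.appid ∧
      e'.challenge = e.challenge ∧ swk v e' = swk v e ∧
      B.Precedes (i, handshakeLength v) n := by
  obtain ⟨i, k, r, e', m, hi, hk, htr, hc, hp⟩ :=
    h.isBundle.exists_regular_of_recv h.not_carries_swk hn (Msg.carries_self _)
  obtain ⟨rfl, rfl, h1, h2, h3, h4⟩ := regular_challenge htr hc
  exact ⟨i, e', hi, hk, h1, h2, h3, h4, hp⟩

theorem eq_of_client (h : ClientSession v b B s e) {i : Fin B.size} {r : Role} {e' : Env}
    (hi : B.strand i = .regular r e') (hr : r.IsClient) (he : e'.cr = e.cr) : i = s ∧ e' = e := by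
  obtain rfl := eq_of_clientRandom h.isBundle h.uniqOrig_cr hi hr he
  have := hi.symm.trans h.strand
  simp only [Strand.regular.injEq] at this
  exact ⟨rfl, this.2⟩

/-- The sender is a client because the write key is secret. The Finished value ties its client
random to that of `e'`, and equality of the write keys ties this to the random of `s`, whose
freshness identifies the strand. -/
theorem clientFinished12_sent (h : ClientSession v b B s e) (hv : v ≠ .tls13) {e' : Env}
    (hkey : cwk v e' = cwk v e) {n : Fin B.size × ℕ}
    (hn : B.HasEvent v b n (.recv (.enc (clientFinished12 v e') (cwk v e')))) :
    clientFinished12 v e' = clientFinished12 v e ∧ B.Precedes (s, 3) n := by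
  rw [hkey] at hn
  obtain ⟨i, k, r, e₁, m, hi, hk, htr, hc, hp⟩ :=
    h.isBundle.exists_regular_of_recv h.not_carries_cwk hn (Msg.carries_self _)
  obtain ⟨hr, rfl, hf⟩ := regular_clientFinished12 hv htr hc
  have hcr : e₁.cr = e.cr := by
    cases v <;> simp_all [clientFinished12, transcript12, cwk, writeKey]
  obtain ⟨rfl, rfl⟩ := h.eq_of_client hi hr hcr
  exact ⟨hf.symm, hp⟩

/-- The server-reg strand of the session. -/
theorem exists_server (h : ClientSession v b B s e) :
    ∃ s' e', B.strand s' = .regular .serverReg e' ∧ handshakeLength v + 1 ≤ B.height s' ∧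
      SameSession v e e' := by
  obtain ⟨i, e', hi, hht, h1, h2, h3, h4, -⟩ := h.exists_challenger
    (n := (s, handshakeLength v)) (h.hasEvent (by cases v <;> rfl))
  refine ⟨i, e', hi, hht, ?_⟩
  by_cases hv : v = .tls13
  · subst hv
    simp [swk, writeKey, transcript13, hellos13, certificate, certificateVerify13] at h4
    constructor <;> simp_all
  · have hkey : cwk v e' = cwk v e := by
      cases v <;> simp_all [cwk, swk, writeKey]
    -- A server that has sent its challenge is past index 3, where it receives the client's Finished
    -- message.
    have hn : B.HasEvent v b (i, 3) (.recv (.enc (clientFinished12 v e') (cwk v e'))) :=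
      hasEvent_of_roleTrace hi (by cases v <;> simp [handshakeLength] at hht <;> omega)
        (by cases v <;> first | rfl | exact absurd rfl hv)
    have hf := (h.clientFinished12_sent hv hkey hn).1
    cases v <;> simp [clientFinished12, transcript12, serverFlight12, certificate, serverKey,
      clientKeyExchange12, masterSecret] at hf hv <;> constructor <;> simp_all

/-- Otherwise the server random would originate at the client's first node, although it originates
only on a server strand. -/
theorem cr_ne_sr (h : ClientSession v b B s e) (hsr : serverRandomFresh v b B s e) :
    e.cr ≠ e.sr := by
  intro heq
  obtain ⟨t, r, e', ht, hr, ho⟩ := hsr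
  have ho' := originatesAt_clientRandom h.isBundle h.strand trivial
  rw [heq] at ho'
  obtain rfl := ho.eq ho'
  have := ht.symm.trans h.strand
  simp only [Strand.regular.injEq] at this
  exact hr (this.1 ▸ trivial)

theorem eq_of_server (h : ClientSession v b B s e) (hsr : serverRandomFresh v b B s e)
    {i j : Fin B.size} {r r' : Role} {e₁ e₂ : Env}
    (hi : B.strand i = .regular r e₁) (hr : r.IsServer) (hhi : 2 ≤ B.height i)
    (hci : e₁.cr = e.cr) (hsi : e₁.sr = e.sr)
    (hj : B.strand j = .regular r' e₂) (hr' : r'.IsServer) (hhj : 2 ≤ B.height j)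
    (hcj : e₂.cr = e.cr) (hsj : e₂.sr = e.sr) : i = j := by
  have hne := h.cr_ne_sr hsr
  obtain ⟨t, -, -, -, -, ho⟩ := hsr
  have hoi := originatesAt_serverRandom h.isBundle hi hr hhi (by rwa [hci, hsi])
  have hoj := originatesAt_serverRandom h.isBundle hj hr' hhj (by rwa [hcj, hsj])
  rw [hsi] at hoi
  rw [hsj] at hoj
  exact (ho.eq hoi).trans (ho.eq hoj).symm

/-- The client receives g^y before it sends g^x, so its exponent is generated at index 2 only
because the server's exponent is a different random one. -/
theorem precedes_share (h : ClientSession .dh12 b B s e) {n : Fin B.size × ℕ}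
    (hn : B.HasEvent .dh12 b n (.recv (.dh e.x))) : B.Precedes (s, 2) n := by
  obtain ⟨a, hx, ha⟩ := h.assumptions.2.2.2.2
  obtain ⟨⟨c, hy, hne⟩, -⟩ := h.shared_dh12 hx ha
  have hev : B.HasEvent .dh12 b (s, 2) (.send (.dh e.x)) := h.hasEvent rfl
  refine h.isBundle.precedes_of_uniqGen ha ⟨⟨_, hev, by simp [Msg.ExptOccurs, hx, Expt.var]⟩, ?_⟩
    hn (by simp [Msg.ExptOccurs, hx, Expt.var])
  intro k hk ev hev
  have hev := hev.regular h.strand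
  simp only at hk hev
  interval_cases k <;> simp [roleTrace, handshake, Flow.clientEvent] at hev <;> subst hev <;>
    simp [Event.msg, Msg.ExptOccurs, serverFlight12, certificate, hy, Expt.var, hne.symm]

theorem precedes_premaster (h : ClientSession .rsa12 b B s e) {n : Fin B.size × ℕ}
    (hn : B.HasEvent .rsa12 b n (.recv (clientKeyExchange12 .rsa12 e))) :
    B.Precedes (s, 2) n := by
  have hev : B.HasEvent .rsa12 b (s, 2) (.send (clientKeyExchange12 .rsa12 e)) := h.hasEvent rfl
  refine h.isBundle.precedes_of_uniqOrig (t := .random48 e.pms) h.assumptions.2.2.2.2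
    ⟨⟨_, hev, by simp [clientKeyExchange12, Msg.Carries]⟩, ?_⟩
    hn (by simp [clientKeyExchange12, Msg.Carries])
  intro k hk ev hev
  have hev := hev.regular h.strand
  simp only at hk hev
  interval_cases k <;> simp [roleTrace, handshake, Flow.clientEvent] at hev <;> subst hev <;>
    simp [Event.msg, Msg.Carries, serverFlight12, certificate]

/-- The client's messages are sent by its strand before they are received. -/
theorem precedes_of_up (h : ClientSession v b B s e) {k : ℕ} (hk : k < handshakeLength v + 1)
    {m : Msg} (hf : (handshake v e ++ registration v b e)[k]? = some (.up m))
    {n : Fin B.size × ℕ} (hn : B.HasEvent v b n (.recv m)) : B.Precedes (s, k) n := by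
  have first : ∀ m, m.Carries (.random32 e.cr) → B.HasEvent v b n (.recv m) →
      B.Precedes (s, 0) n := fun m hm hn =>
    h.isBundle.precedes_of_uniqOrig h.uniqOrig_cr
      (originatesAt_clientRandom h.isBundle h.strand trivial) hn hm
  cases v <;> simp only [handshakeLength] at hk <;> interval_cases k <;>
    simp [handshake, registration] at hf <;> subst hf
  · exact first _ (Msg.carries_self _) hn
  · exact h.precedes_premaster hn
  · exact (h.clientFinished12_sent (by simp) rfl hn).2
  · exact first _ (Msg.carries_self _) hn
  · exact h.precedes_share hn
  · exact (h.clientFinished12_sent (by simp) rfl hn).2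
  · exact first _ (Msg.Carries.fst (Msg.carries_self _)) hn
  · obtain ⟨i, k, r, e₁, m, hi, hk, htr, hc, hp⟩ :=
      h.isBundle.exists_regular_of_recv (h.not_carries_handshakeKey (by simp)) hn
        (Msg.carries_self _)
    obtain ⟨hr, rfl, hf⟩ := regular_clientFinished13 htr hc
    simp [hellos13] at hf
    obtain ⟨rfl, -⟩ := h.eq_of_client hi hr hf.1.1
    exact hp

/-- The server's messages are sent by its strand before they are received. -/
theorem precedes_of_down (h : ClientSession v b B s e) (hsr : serverRandomFresh v b B s e)
    {s' : Fin B.size} {e' : Env} (hs' : B.strand s' = .regular .serverReg e')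
    (hht : handshakeLength v + 1 ≤ B.height s') (he' : SameSession v e e')
    {k : ℕ} (hk : k < handshakeLength v + 1)
    {m : Msg} (hf : (handshake v e ++ registration v b e)[k]? = some (.down m))
    {n : Fin B.size × ℕ} (hn : B.HasEvent v b n (.recv m)) : B.Precedes (s', k) n := by
  have h2 : 2 ≤ B.height s' := by cases v <;> simp [handshakeLength] at hht <;> omega
  have uniq : ∀ {i r e₁}, B.strand i = .regular r e₁ → r.IsServer → 2 ≤ B.height i →
      e₁.cr = e.cr → e₁.sr = e.sr → i = s' := fun hi hr hhi hci hsi =>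
    h.eq_of_server hsr hi hr hhi hci hsi hs' id h2 he'.cr he'.sr
  have second : ∀ m, m.Carries (.random32 e.sr) → B.HasEvent v b n (.recv m) →
      B.Precedes (s', 1) n := fun m hm hn => by
    have hne := h.cr_ne_sr hsr
    obtain ⟨t, r, e₁, ht, hr, ho⟩ := hsr
    have ho' := originatesAt_serverRandom h.isBundle hs' id h2 (by rwa [he'.cr, he'.sr])
    rw [he'.sr] at ho'
    exact h.isBundle.precedes_of_uniqOrig ho ho' hn hm
  -- The authentication tests below yield some server strand with the right randoms. Freshness of
  -- the server random identifies it with `s'`.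
  have last : ∀ {n}, B.HasEvent v b n
      (.recv (.enc (.name e.username ⋆ .name e.appid ⋆ .text e.challenge) (swk v e))) →
      B.Precedes (s', handshakeLength v) n := fun hn => by
    obtain ⟨i, e₁, hi, hhi, -, -, -, h4, hp⟩ := h.exists_challenger hn
    have hr : e₁.cr = e.cr ∧ e₁.sr = e.sr := by
      cases v <;> simp [swk, writeKey, transcript13, hellos13] at h4 <;> simp [h4]
    obtain rfl := uniq hi id (by cases v <;> simp [handshakeLength] at hhi <;> omega) hr.1 hr.2
    exact hp
  have finished : v ≠ .tls13 → ∀ {n}, B.HasEvent v b n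
      (.recv (.enc (serverFinished12 v e) (swk v e))) → B.Precedes (s', 4) n := fun hv n hn => by
    obtain ⟨i, k, r, e₁, m, hi, hk, htr, hc, hp⟩ :=
      h.isBundle.exists_regular_of_recv h.not_carries_swk hn (Msg.carries_self _)
    obtain ⟨hr, rfl, hf⟩ := regular_serverFinished12 hv htr hc
    have hcs : e₁.cr = e.cr ∧ e₁.sr = e.sr := by
      cases v <;> simp_all [serverFinished12, transcript12, serverFlight12]
    obtain rfl := uniq hi hr (by omega) hcs.1 hcs.2
    exact hp
  cases v <;> simp only [handshakeLength] at hk <;> interval_cases k <;>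
    simp [handshake, registration] at hf <;> subst hf
  · exact second _ (Msg.Carries.fst (Msg.carries_self _)) hn
  · exact finished (by simp) hn
  · exact last hn
  · exact second _ (Msg.Carries.fst (Msg.carries_self _)) hn
  · exact finished (by simp) hn
  · exact last hn
  · exact second _ (Msg.Carries.fst (Msg.carries_self _)) hn
  · obtain ⟨i, k, r, e₁, m, hi, hk, htr, hc, hp⟩ :=
      h.isBundle.exists_regular_of_recv (h.not_carries_handshakeKey (by simp)) hn
        (Msg.carries_self _)
    obtain ⟨hr, rfl, hf⟩ := regular_serverFlight13 htr hc
    simp [hellos13] at hf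
    obtain rfl := uniq hi hr (by omega) hf.1.1 hf.2.1
    exact hp
  · exact last hn

theorem containsIdeal (h : ClientSession v b B s e) (hsr : serverRandomFresh v b B s e)
    {s' : Fin B.size} {e' : Env} (hs' : B.strand s' = .regular .serverReg e')
    (hht : handshakeLength v + 1 ≤ B.height s') (he' : SameSession v e e') :
    ContainsIdeal v b B s s' := by
  refine ⟨⟨e', hs'⟩, hht, fun k hk => ?_⟩
  have hlen : k < (handshake v e ++ registration v b e).length := by
    simp [length_handshake, registration]
    omega
  obtain ⟨f, hf⟩ : ∃ f, (handshake v e ++ registration v b e)[k]? = some f :=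
    ⟨_, List.getElem?_eq_getElem hlen⟩
  have hc : B.HasEvent v b (s, k) f.clientEvent := h.hasEvent (by simp only [roleTrace,
    List.getElem?_map, hf, Option.map_some])
  have hs : B.HasEvent v b (s', k) f.serverEvent :=
    hasEvent_of_roleTrace hs' (hk.trans_le hht) (by
      simp only [roleTrace, List.getElem?_map, he'.flow_eq b hk, hf, Option.map_some])
  cases f with
  | up m => exact ⟨m, .inl ⟨hc, hs, h.precedes_of_up hk hf hs⟩⟩
  | down m => exact ⟨m, .inr ⟨hc, hs, h.precedes_of_down hsr hs' hht he' hk hf hc⟩⟩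

theorem exists_containsIdeal (h : ClientSession v b B s e)
    (hsr : serverRandomFresh v b B s e) :
    ∃ s', ContainsIdeal v b B s s' ∧
      ∀ t r e', B.strand t = .regular r e' → Role.clientReg.Complementary r →
        handshakeLength v + 1 ≤ B.height t → regContext v (.clientReg, e) (r, e') → t = s' := by
  obtain ⟨s', e', hs', hht, he'⟩ := h.exists_server
  refine ⟨s', h.containsIdeal hsr hs' hht he', ?_⟩
  intro t r e₁ ht hr hh hctx
  have h2 : ∀ {i}, handshakeLength v + 1 ≤ B.height i → 2 ≤ B.height i := fun hi => by
    cases v <;> simp [handshakeLength] at hi <;> omega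
  have hcr : e₁.cr = e.cr := by
    obtain ⟨m, h1, h2⟩ := hctx .cr (by cases v <;> simp [tlsContextVars])
    have := h1.trans h2.symm
    simp [value] at this
    exact this.symm
  have hsr' : e₁.sr = e.sr := by
    obtain ⟨m, h1, h2⟩ := hctx .sr (by cases v <;> simp [tlsContextVars])
    have := h1.trans h2.symm
    simp [value] at this
    exact this.symm
  exact h.eq_of_server hsr ht (hr.mp trivial) (h2 hh) hcr hsr' hs' id (h2 hht) he'.cr he'.sr

end ClientSession

end Graph

end UAF

/-! ### The ideal execution -/

namespace UAF

def Flow.msg : Flow → Msg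
  | .up m => m
  | .down m => m

/-- Client and server messages of a registration, in order. -/
noncomputable def regFlows (v : TLS) (b : Binding) (e : Env) : List Flow :=
  handshake v e ++ registration v b e

/-- The events of the ideal execution: strand `0` is the client, strand `1` the server. -/
noncomputable def Flow.event (i : Fin 2) (f : Flow) : Event :=
  if i = 0 then f.clientEvent else f.serverEvent

/-- The strand of the ideal execution that sends the message. -/
def Flow.sender : Flow → Fin 2
  | .up _ => 0
  | .down _ => 1

@[simp] theorem Flow.msg_event (i : Fin 2) (f : Flow) : (f.event i).msg = f.msg := by
  cases f <;> simp only [Flow.event] <;> split <;> rfl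

theorem Flow.event_eq_send {i : Fin 2} {f : Flow} {m : Msg} :
    f.event i = .send m ↔ f.msg = m ∧ i = f.sender := by
  fin_cases i <;> cases f <;>
    simp [Flow.event, Flow.clientEvent, Flow.serverEvent, Flow.msg, Flow.sender]

theorem Flow.event_eq_recv {i : Fin 2} {f : Flow} {m : Msg} :
    f.event i = .recv m ↔ f.msg = m ∧ i ≠ f.sender := by
  fin_cases i <;> cases f <;>
    simp [Flow.event, Flow.clientEvent, Flow.serverEvent, Flow.msg, Flow.sender]

noncomputable def idealHeight (v : TLS) (i : Fin 2) : ℕ :=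
  if i = 0 then handshakeLength v + 2 else handshakeLength v + 1

/-- The ideal execution of registration. -/
noncomputable def idealGraph (v : TLS) (b : Binding) (e : Env) : Graph where
  size := 2
  strand i := if i = 0 then .regular .clientReg e else .regular .serverReg e
  height := idealHeight v
  comm n n' := n.1 ≠ n'.1 ∧ n.2 = n'.2 ∧ n.2 < idealHeight v n.1 ∧ n'.2 < idealHeight v n'.1 ∧
    ∃ f, (regFlows v b e)[n.2]? = some f ∧ n.1 = f.sender

variable {v : TLS} {b : Binding} {e : Env}

theorem length_regFlows : (regFlows v b e).length = handshakeLength v + 2 := by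
  simp [regFlows, length_handshake, registration]

theorem ideal_hasEvent {n : Fin 2 × ℕ} {ev : Event} :
    (idealGraph v b e).HasEvent v b n ev ↔ n.2 < idealHeight v n.1 ∧
      ∃ f, (regFlows v b e)[n.2]? = some f ∧ f.event n.1 = ev := by
  obtain ⟨i, k⟩ := n
  fin_cases i <;>
    simp [Graph.HasEvent, idealGraph, Strand.trace, roleTrace, regFlows, Flow.event,
      List.getElem?_map, -List.map_append]

theorem ideal_comm {n n' : Fin 2 × ℕ} :
    (idealGraph v b e).comm n n' ↔ n.1 ≠ n'.1 ∧ n.2 = n'.2 ∧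
      ∃ m, (idealGraph v b e).HasEvent v b n (.send m) ∧
        (idealGraph v b e).HasEvent v b n' (.recv m) := by
  simp only [ideal_hasEvent, Flow.event_eq_send, Flow.event_eq_recv]
  constructor
  · rintro ⟨h1, h2, h3, h4, f, h5, h6⟩
    exact ⟨h1, h2, f.msg, ⟨h3, f, h5, rfl, h6⟩, h4, f, h2 ▸ h5, rfl, h6 ▸ h1.symm⟩
  · rintro ⟨h1, h2, m, ⟨h3, f, h5, -, h6⟩, h4, -⟩
    exact ⟨h1, h2, h3, h4, f, h5, h6⟩

/-- The last message of registration is the client's. -/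
theorem lt_idealHeight {k : ℕ} {f : Flow} (hf : (regFlows v b e)[k]? = some f)
    {i : Fin 2} (h : k < idealHeight v i) : k < idealHeight v f.sender := by
  have hk : k < handshakeLength v + 2 := by
    rw [← length_regFlows (v := v) (b := b) (e := e)]
    exact (List.getElem?_eq_some_iff.mp hf).1
  cases f with
  | up m => simpa [Flow.sender, idealHeight] using hk
  | down m =>
    have hne : k ≠ handshakeLength v + 1 := by
      rintro rfl
      cases v <;> simp [regFlows, handshake, registration, handshakeLength] at hf
    simp only [Flow.sender, idealHeight]
    simp
    omega

theorem ideal_isBundle : (idealGraph v b e).IsBundle v b where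
  height_pos i := by
    change 0 < idealHeight v i
    unfold idealHeight
    split <;> omega
  height_le i := by
    change idealHeight v i ≤ _
    fin_cases i <;> simp [idealGraph, Strand.trace, length_roleTrace, idealHeight, roleHeight]
  comm_event n n' hc := by
    obtain ⟨h1, -, h2⟩ := ideal_comm.mp hc
    exact ⟨h1, h2⟩
  recv_unique n' m hm := by
    obtain ⟨i, k⟩ := n'
    obtain ⟨hk, f, hf, hev⟩ := ideal_hasEvent.mp hm
    obtain ⟨-, hne⟩ := Flow.event_eq_recv.mp hev
    refine ⟨(f.sender, k), ⟨hne.symm, rfl, lt_idealHeight hf hk, hk, f, hf, rfl⟩, ?_⟩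
    rintro ⟨j, l⟩ ⟨-, rfl, -, -, f', hf', hj⟩
    simp only at hf hf' hj
    obtain rfl : f = f' := Option.some.inj (hf.symm.trans hf')
    rw [hj]
  acyclic := by
    classical
    -- Message `k` has rank `2k` at its sender and `2k + 1` at its receiver, so both kinds of edges
    -- increase the rank.
    let rank : Fin 2 × ℕ → ℕ := fun n =>
      2 * n.2 + if ∃ f, (regFlows v b e)[n.2]? = some f ∧ n.1 = f.sender then 0 else 1
    have step : ∀ n n' : Fin 2 × ℕ, (idealGraph v b e).Edge n n' → rank n < rank n' := by
      rintro ⟨i, k⟩ ⟨j, l⟩ (⟨h1, h2, -, -, f, h5, h6⟩ | ⟨-, h2, -⟩)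
      · simp only at h1 h2 h5 h6
        subst h2
        have hj : j ≠ f.sender := h6 ▸ h1.symm
        simp [rank, h5, h6, hj]
      · simp only at h2
        subst h2
        simp only [rank]
        split <;> split <;> omega
    have mono : ∀ n n' : Fin 2 × ℕ, (idealGraph v b e).Precedes n n' → rank n < rank n' := by
      intro n n' hp
      induction hp with
      | single h => exact step _ _ h
      | tail _ h ih => exact ih.trans (step _ _ h)
    exact fun n hp => lt_irrefl _ (mono n n hp)

/-- In the ideal execution, a property first acquired in the `k`-th message is first acquired
at the transmission of that message. -/
theorem ideal_first (Q : Msg → Prop) {k : ℕ} {f : Flow} (hk : k < handshakeLength v + 1)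
    (hf : (regFlows v b e)[k]? = some f) (hQ : Q f.msg)
    (hfirst : ∀ j < k, ∀ f', (regFlows v b e)[j]? = some f' → ¬ Q f'.msg) (n : Fin 2 × ℕ) :
    ((∃ m, (idealGraph v b e).HasEvent v b n (.send m) ∧ Q m) ∧
      ∀ l < n.2, ∀ ev, (idealGraph v b e).HasEvent v b (n.1, l) ev → ¬ Q ev.msg) ↔
      n = (f.sender, k) := by
  -- Both strands contain message `k`, so neither can acquire the property first at a later message.
  have hht : ∀ i : Fin 2, k < idealHeight v i := fun i => by
    unfold idealHeight
    split <;> omega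
  constructor
  · rintro ⟨⟨m, hm, hQm⟩, hlt⟩
    obtain ⟨i, l⟩ := n
    obtain ⟨-, f', hf', hev⟩ := ideal_hasEvent.mp hm
    obtain ⟨rfl, hi⟩ := Flow.event_eq_send.mp hev
    simp only at hf' hlt hi
    rcases lt_trichotomy l k with h | rfl | h
    · exact absurd hQm (hfirst l h f' hf')
    · obtain rfl : f = f' := Option.some.inj (hf.symm.trans hf')
      rw [hi]
    · refine absurd ?_ (hlt k h (f.event i) (ideal_hasEvent.mpr ⟨hht i, f, hf, rfl⟩))
      rwa [Flow.msg_event]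
  · rintro rfl
    refine ⟨⟨f.msg, ideal_hasEvent.mpr ⟨hht _, f, hf, Flow.event_eq_send.mpr ⟨rfl, rfl⟩⟩, hQ⟩, ?_⟩
    intro l hl ev hev
    obtain ⟨-, f', hf', rfl⟩ := ideal_hasEvent.mp hev
    rw [Flow.msg_event]
    exact hfirst l hl f' hf'

theorem ideal_uniqOrig {t : Msg} {k : ℕ} {f : Flow} (hk : k < handshakeLength v + 1)
    (hf : (regFlows v b e)[k]? = some f) (ht : f.msg.Carries t)
    (hfirst : ∀ j < k, ∀ f', (regFlows v b e)[j]? = some f' → ¬ f'.msg.Carries t) :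
    (idealGraph v b e).UniqOrig v b t f.sender :=
  ⟨k, ideal_first (fun m => m.Carries t) hk hf ht hfirst⟩

theorem ideal_uniqGen {a : ℕ} {k : ℕ} {f : Flow} (hk : k < handshakeLength v + 1)
    (hf : (regFlows v b e)[k]? = some f) (ht : f.msg.ExptOccurs a)
    (hfirst : ∀ j < k, ∀ f', (regFlows v b e)[j]? = some f' → ¬ f'.msg.ExptOccurs a) :
    (idealGraph v b e).UniqGen v b a f.sender :=
  ⟨k, ideal_first (fun m => m.ExptOccurs a) hk hf ht hfirst⟩

/-- Private keys occur only as signing keys and under the hash of the key handle or the channel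
binding, positions that are not carried. -/
theorem ideal_nonOrig (k : AKey) : (idealGraph v b e).NonOrig v b (.priv k) := by
  intro n ev hev
  obtain ⟨-, f, hf, rfl⟩ := ideal_hasEvent.mp hev
  rw [Flow.msg_event]
  have hmem := List.mem_of_getElem? hf
  revert f
  suffices h : ∀ f ∈ regFlows v b e, ¬ f.msg.Carries (.priv k) from fun f _ _ => h f
  cases v <;> simp [regFlows, handshake, registration, Flow.msg, Msg.Carries, serverFlight12,
    certificate, clientKeyExchange12, clientFinished12, serverFinished12, certificateVerify13,
    serverFinished13, clientFinished13, keyHandle, finalChallenge, regAssertion]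

/-- Distinctness of the exponents matters in TLS 1.3: there g^x precedes g^y, and a common exponent
would be generated by the client. -/
theorem ideal_uniqGen_y (hv : v.IsDH) (hx : ∃ a, e.x = Expt.var a) (hne : e.x ≠ e.y) {c : ℕ}
    (hy : e.y = Expt.var c) : (idealGraph v b e).UniqGen v b c (1 : Fin 2) := by
  obtain ⟨a, ha⟩ := hx
  have hac : c ≠ a := by
    rintro rfl
    exact hne (ha.trans hy.symm)
  cases v with
  | rsa12 => exact hv.elim
  | dh12 =>
    refine ideal_uniqGen (k := 1) (f := .down (serverFlight12 .dh12 e)) (by simp [handshakeLength]) rfl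
      (by simp [Flow.msg, serverFlight12, Msg.ExptOccurs, hy, Expt.var]) ?_
    intro j hj f hf
    interval_cases j
    simp [regFlows, handshake] at hf
    subst hf
    simp [Flow.msg, Msg.ExptOccurs]
  | tls13 =>
    refine ideal_uniqGen (k := 1) (f := .down (.random32 e.sr ⋆ .dh e.y)) (by simp [handshakeLength]) rfl
      (by simp [Flow.msg, Msg.ExptOccurs, hy, Expt.var]) ?_
    intro j hj f hf
    interval_cases j
    simp [regFlows, handshake] at hf
    subst hf
    simp [Flow.msg, Msg.ExptOccurs, ha, Expt.var, hac.symm]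

theorem ideal_inSpace (hc : WellSorted v .clientReg e) (hs : WellSorted v .serverReg e)
    (hne : v.IsDH → e.x ≠ e.y) : (idealGraph v b e).InSpace v b where
  isBundle := ideal_isBundle
  wellSorted i r e' h := by
    change Fin 2 at i
    fin_cases i <;> simp [idealGraph] at h <;> obtain ⟨rfl, rfl⟩ := h <;> assumption
  server_fresh hv i r e' c h hr _ hy := by
    change Fin 2 at i
    fin_cases i <;> simp [idealGraph] at h <;> obtain ⟨rfl, rfl⟩ := h
    · exact (hr trivial).elim
    · exact ideal_uniqGen_y hv ((hc hv).1 trivial) (hne hv) hy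

theorem ideal_clientAssumptions (hc : WellSorted v .clientReg e)
    (hs : WellSorted v .serverReg e) (hne : v.IsDH → e.x ≠ e.y) :
    clientAssumptions v b (idealGraph v b e) (0 : Fin 2) e := by
  refine ⟨ideal_nonOrig _, ideal_nonOrig _, ideal_nonOrig _, ?_, ?_⟩
  · cases v with
    | tls13 =>
      exact ideal_uniqOrig (k := 0) (f := .up (.random32 e.cr ⋆ .dh e.x)) (by simp) rfl
        (Msg.Carries.fst (Msg.carries_self _)) (by simp)
    | _ =>
      exact ideal_uniqOrig (k := 0) (f := .up (.random32 e.cr)) (by simp) rfl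
        (Msg.carries_self _) (by simp)
  · cases v with
    | rsa12 =>
      refine ideal_uniqOrig (k := 2) (f := .up (clientKeyExchange12 .rsa12 e))
        (by simp [handshakeLength]) rfl
        (by simp [Flow.msg, clientKeyExchange12, Msg.Carries]) ?_
      intro j hj f hf
      interval_cases j <;> simp [regFlows, handshake] at hf <;> subst hf <;>
        simp [Flow.msg, Msg.Carries, serverFlight12, certificate]
    | dh12 =>
      obtain ⟨a, ha⟩ := (hc trivial).1 trivial
      obtain ⟨c, hy⟩ := (hs trivial).2 id
      -- In this variant the server's share comes first, so distinctness is what keeps the client's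
      -- exponent out of the earlier messages.
      have hac : a ≠ c := by
        rintro rfl
        exact hne trivial (ha.trans hy.symm)
      refine ⟨a, ha, ideal_uniqGen (k := 2) (f := .up (.dh e.x))
        (by simp [handshakeLength]) rfl
        (by simp [Flow.msg, Msg.ExptOccurs, ha, Expt.var]) ?_⟩
      intro j hj f hf
      interval_cases j <;> simp [regFlows, handshake] at hf <;> subst hf <;>
        simp [Flow.msg, Msg.ExptOccurs, serverFlight12, certificate, hy, Expt.var, hac.symm]
    | tls13 =>
      obtain ⟨a, ha⟩ := (hc trivial).1 trivial
      exact ⟨a, ha, ideal_uniqGen (k := 0) (f := .up (.random32 e.cr ⋆ .dh e.x)) (by simp) rfl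
        (by simp [Flow.msg, Msg.ExptOccurs, ha, Expt.var]) (by simp)⟩

theorem ideal_serverRandomFresh (hne : e.cr ≠ e.sr) :
    serverRandomFresh v b (idealGraph v b e) (0 : Fin 2) e := by
  refine ⟨(1 : Fin 2), .serverReg, e, rfl, id, ?_⟩
  cases v with
  | tls13 =>
    refine ideal_uniqOrig (k := 1) (f := .down (.random32 e.sr ⋆ .dh e.y)) (by simp [handshakeLength]) rfl
      (Msg.Carries.fst (Msg.carries_self _)) ?_
    intro j hj f hf
    interval_cases j
    simp [regFlows, handshake] at hf
    subst hf
    simp [Flow.msg, Msg.Carries, hne.symm]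
  | _ =>
    refine ideal_uniqOrig (k := 1) (f := .down (serverFlight12 _ e)) (by simp [handshakeLength]) rfl
      (Msg.Carries.fst (Msg.carries_self _)) ?_
    intro j hj f hf
    interval_cases j
    simp [regFlows, handshake] at hf
    subst hf
    simp [Flow.msg, Msg.Carries, hne.symm]

theorem ideal_isIdealExecution :
    IsIdealExecution v b e (idealGraph v b e) (0 : Fin 2) (1 : Fin 2) where
  client := rfl
  server := rfl
  only t := by
    change Fin 2 at t
    fin_cases t
    · exact .inl rfl
    · exact .inr rfl
  client_height := rfl
  server_height := rfl
  comm_iff _ _ := ideal_comm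

theorem singleShape : SingleShape v b := by
  refine ⟨fun e hc hs hr hx => ?_, fun B hB s e hs hh ha hsr => ?_⟩
  · exact ⟨idealGraph v b e, (0 : Fin 2), (1 : Fin 2), ideal_inSpace hc hs hx,
      ideal_isIdealExecution, ideal_clientAssumptions hc hs hx, ideal_serverRandomFresh hr⟩
  · exact Graph.ClientSession.exists_containsIdeal ⟨hB, hs, hh, ha⟩ hsr

/-! ### Context agreement -/

theorem successful_serverReg : Successful v b .clientReg .serverReg (regContext v)
    (clientAssumptions v b) (roleHeight v .clientReg) (handshakeLength v + 1) := by
  intro B hB s e hs hh ha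
  obtain ⟨s', e', h1, h2, h3⟩ := Graph.ClientSession.exists_server ⟨hB, hs, hh, ha⟩
  exact ⟨s', e', h1, h2, by simp [Role.Complementary, Role.IsServer, Role.IsClient],
    h3.regContext⟩

/-- Only the role server-reg can complete the registration context. -/
theorem eq_serverReg_of_successful {R : Role} {j : ℕ}
    (h : Successful v b .clientReg R (regContext v) (clientAssumptions v b)
      (roleHeight v .clientReg) j) : R = .serverReg := by
  -- Any values with two different random exponents would do. They make an ideal execution to which
  -- the hypothesis applies, so that it is not vacuous.
  let e : Env := ⟨0, 0, 0, 0, 0, 0, 0, 0, 1, 0, Expt.var 0, Expt.var 1, .other 0, .other 0, 0⟩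
  have hc : WellSorted v .clientReg e := fun _ => ⟨fun _ => ⟨0, rfl⟩, fun _ => ⟨1, rfl⟩⟩
  have hs : WellSorted v .serverReg e := fun _ => ⟨fun _ => ⟨0, rfl⟩, fun _ => ⟨1, rfl⟩⟩
  have hxy : v.IsDH → e.x ≠ e.y := fun _ heq => by
    have := DFunLike.congr_fun heq 0
    simp [e, Expt.var] at this
  obtain ⟨-, e', -, -, hR, hctx⟩ := h (idealGraph v b e) (ideal_inSpace hc hs hxy) (0 : Fin 2) e
    rfl le_rfl (ideal_clientAssumptions hc hs hxy)
  -- Complementarity excludes the client roles, and agreement on the username excludes server-auth,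
  -- which has no such variable.
  obtain ⟨m, -, hm⟩ := hctx .username (by simp)
  cases R <;> simp [value, Role.Complementary, Role.IsServer, Role.IsClient] at hm hR ⊢

theorem contextAgreementAt : ContextAgreementAt v b .clientReg .serverReg (regContext v)
    (clientAssumptions v b) (handshakeLength v + 1) :=
  ⟨successful_serverReg, fun _ _ h₁ h₂ =>
    (eq_serverReg_of_successful h₁).trans (eq_serverReg_of_successful h₂).symm⟩

end UAF

theorem theorem1 (v : UAF.TLS) (b : UAF.Binding) (hvb : UAF.Modelled v b) :
    UAF.ContextAgreement v b .clientReg .serverReg (UAF.regContext v) (UAF.clientAssumptions v b) ∧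
    UAF.ContextAgreementAt v b .clientReg .serverReg (UAF.regContext v)
      (UAF.clientAssumptions v b) (UAF.handshakeLength v + 1) ∧
    UAF.SingleShape v b :=
  ⟨⟨_, by simp [UAF.roleHeight], UAF.contextAgreementAt⟩, UAF.contextAgreementAt,
    UAF.singleShape⟩
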